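/- Let $0<\mu<1$ and let $L^2(e^{\mu x})$ be the real Hilbert space of (classes of) functions $h$ on $(0,\infty)$ with norm $\|h\|_{L^2(e^{\mu x})}=\bigl(\int_0^\infty |h(x)|^2e^{\mu x}\,dx\bigr)^{1/2}<\infty$. For $h\in C_c^\infty(0,\infty)$ put $$\mathcal L_0[h](x)=x\,h'(x)-2H(x)+2\int_0^x H(y)\,e^{-(x-y)}\,dy,\qquad H(x)=\int_x^\infty h(z)\,dz .$$ **Proposition.** $\mathcal L_0$ generates a strongly continuous semigroup $(e^{\mathcal L_0t})_{t\ge 0}$ on $L^2(e^{\mu x})$; that is, $\mathcal L_0$, as an unbounded operator on $L^2(e^{\mu x})$ with domain $C_c^\infty(0,\infty)$, is closable and its closure is the infinitesimal generator of a strongly continuous semigroup. Moreover, for each $\lambda\in(-\infty,1/2]$ there exists $C_\lambda>0$ such that $$\|e^{\mathcal L_0t}h_0\|_{L^2(e^{\mu x})}\le C_\lambda\,e^{-\lambda t}\,\|h_0\|_{L^2(e^{\mu x})}$$ for all $t\ge 0$ and all $h_0\in L^2(e^{\mu x})$ with $\int_0^\infty x\,h_0(x)\,dx=0$. -/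

import Mathlib

open Set MeasureTheory Filter Topology Distributions
open scoped NNReal ENNReal

/-! ### Strongly continuous semigroups and their generators -/

/-- A strongly continuous one-parameter semigroup `(T t)`, `t ≥ 0`, of bounded linear operators on
a real normed space `E`. -/
structure C0Semigroup (E : Type*) [NormedAddCommGroup E] [NormedSpace ℝ E] where
  /-- the operator at time `t` -/
  op : ℝ≥0 → E →L[ℝ] E
  op_zero : op 0 = ContinuousLinearMap.id ℝ E
  op_add : ∀ s t : ℝ≥0, op (s + t) = (op s).comp (op t)
  continuous_orbit : ∀ x : E, Continuous fun t => op t x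

namespace C0Semigroup

variable {E : Type*} [NormedAddCommGroup E] [NormedSpace ℝ E]

/-- `y` is the derivative at `t = 0⁺` of the orbit of `x`:
`(T t x - x) / t → y` in norm as `t ↓ 0`. -/
def HasGen (T : C0Semigroup E) (x y : E) : Prop :=
  Tendsto (fun t : ℝ≥0 => (t : ℝ)⁻¹ • (T.op t x - x)) (𝓝[>] 0) (𝓝 y)

theorem HasGen.add {T : C0Semigroup E} {x x' y y' : E} (h : T.HasGen x y) (h' : T.HasGen x' y') :
    T.HasGen (x + x') (y + y') := by
  refine (Tendsto.add h h').congr fun t => ?_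
  rw [← smul_add, map_add]
  congr 1
  abel

theorem HasGen.smul {T : C0Semigroup E} {x y : E} (c : ℝ) (h : T.HasGen x y) :
    T.HasGen (c • x) (c • y) := by
  refine (Tendsto.const_smul h c).congr fun t => ?_
  rw [smul_comm, map_smul, smul_sub]

theorem HasGen.zero (T : C0Semigroup E) : T.HasGen 0 0 := by
  simp [HasGen]

theorem HasGen.unique {T : C0Semigroup E} {x y y' : E} (h : T.HasGen x y) (h' : T.HasGen x y') :
    y = y' :=
  tendsto_nhds_unique h h'

/-- The infinitesimal generator: the unbounded operator `A x = lim_{t ↓ 0} (T t x - x) / t` whose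
domain consists of all `x` for which this limit exists in norm. -/
noncomputable def generator (T : C0Semigroup E) : E →ₗ.[ℝ] E where
  domain :=
    { carrier := {x | ∃ y, T.HasGen x y}
      add_mem' := fun ⟨_, h⟩ ⟨_, h'⟩ => ⟨_, h.add h'⟩
      zero_mem' := ⟨0, HasGen.zero T⟩
      smul_mem' := fun c _ ⟨_, h⟩ => ⟨_, h.smul c⟩ }
  toFun :=
    { toFun := fun x => x.2.choose
      map_add' := fun x x' =>
        (x + x').2.choose_spec.unique (x.2.choose_spec.add x'.2.choose_spec)
      map_smul' := fun c x => (c • x).2.choose_spec.unique (x.2.choose_spec.smul c) }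

theorem mem_generator_graph_iff (T : C0Semigroup E) (x y : E) :
    (x, y) ∈ T.generator.graph ↔ T.HasGen x y := by
  rw [LinearPMap.mem_graph_iff]
  constructor
  · rintro ⟨z, hz, hy⟩
    simp only at hz hy
    subst hz hy
    exact z.2.choose_spec
  · intro h
    exact ⟨⟨x, y, h⟩, rfl, (Exists.choose_spec (p := fun y => T.HasGen x y) ⟨y, h⟩).unique h⟩

end C0Semigroup

/-- The densely defined operator `L`, understood through its closure, generates the semigroup `T`:
`L` is closable and its closure is the infinitesimal generator of `T`. -/
def Generates {E : Type*} [NormedAddCommGroup E] [NormedSpace ℝ E]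
    (L : E →ₗ.[ℝ] E) (T : C0Semigroup E) : Prop :=
  L.IsClosable ∧ L.closure = T.generator

/-! ### The weighted space `L²(e^{μx})` on the half line -/

/-- The measure `e^{μx} dx` on `(0, ∞)`. -/
noncomputable def expMeasure (μ : ℝ) : Measure ℝ :=
  (volume.restrict (Ioi 0)).withDensity fun x => ENNReal.ofReal (Real.exp (μ * x))

/-- The real Hilbert space `L²(e^{μx})` of functions on `(0, ∞)`, with norm
`‖h‖² = ∫₀^∞ |h(x)|² e^{μx} dx`. -/
abbrev L2Exp (μ : ℝ) : Type := Lp ℝ 2 (expMeasure μ)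

/-- The open half line `(0, ∞)`. -/
def halfLine : TopologicalSpace.Opens ℝ := ⟨Ioi 0, isOpen_Ioi⟩

/-! ### The linearised operator on `C_c^∞(0, ∞)` -/

/-- The primitive `H(x) = ∫_x^∞ h(z) dz`. -/
noncomputable def tailPrimitive (h : ℝ → ℝ) (x : ℝ) : ℝ := ∫ z in Ioi x, h z

/-- `L₀[h](x) = x h'(x) - 2 H(x) + 2 ∫_0^x H(y) e^{-(x-y)} dy` with `H(x) = ∫_x^∞ h(z) dz`. -/
noncomputable def linCoag (h : ℝ → ℝ) (x : ℝ) : ℝ :=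
  x * deriv h x - 2 * tailPrimitive h x
    + 2 * ∫ y in (0 : ℝ)..x, tailPrimitive h y * Real.exp (-(x - y))

section MemLp

theorem tailPrimitive_eq (φ : 𝓓(halfLine, ℝ)) (x : ℝ) :
    tailPrimitive φ x = (∫ z in Ioi 0, φ z) - ∫ z in (0 : ℝ)..x, φ z := by
  have hi : Integrable φ := φ.continuous.integrable_of_hasCompactSupport φ.hasCompactSupport
  have := intervalIntegral.integral_interval_add_Ioi (f := φ) (μ := volume) (a := 0) (b := x)
    hi.integrableOn hi.integrableOn
  rw [tailPrimitive]
  linarith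

theorem continuous_tailPrimitive (φ : 𝓓(halfLine, ℝ)) : Continuous (tailPrimitive φ) := by
  have h : tailPrimitive φ = fun x => (∫ z in Ioi 0, φ z) - ∫ z in (0 : ℝ)..x, φ z :=
    funext (tailPrimitive_eq φ)
  rw [h]
  exact continuous_const.sub
    (intervalIntegral.continuous_primitive (fun a b => φ.continuous.intervalIntegrable a b) 0)

theorem tailPrimitive_add (φ ψ : 𝓓(halfLine, ℝ)) (x : ℝ) :
    tailPrimitive (φ + ψ : 𝓓(halfLine, ℝ)) x = tailPrimitive φ x + tailPrimitive ψ x := by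
  have hi : Integrable φ := φ.continuous.integrable_of_hasCompactSupport φ.hasCompactSupport
  have hj : Integrable ψ := ψ.continuous.integrable_of_hasCompactSupport ψ.hasCompactSupport
  exact integral_add hi.integrableOn hj.integrableOn

theorem tailPrimitive_smul (c : ℝ) (φ : 𝓓(halfLine, ℝ)) (x : ℝ) :
    tailPrimitive (c • φ : 𝓓(halfLine, ℝ)) x = c * tailPrimitive φ x :=
  integral_const_mul c _

theorem linCoag_add (φ ψ : 𝓓(halfLine, ℝ)) :
    linCoag (φ + ψ : 𝓓(halfLine, ℝ)) = linCoag φ + linCoag ψ := by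
  funext x
  have h1 : deriv (φ + ψ : 𝓓(halfLine, ℝ)) x = deriv φ x + deriv ψ x :=
    deriv_add (φ.contDiff.differentiable (by simp) x) (ψ.contDiff.differentiable (by simp) x)
  have h2 : ∀ χ : 𝓓(halfLine, ℝ), IntervalIntegrable
      (fun y => tailPrimitive χ y * Real.exp (-(x - y))) volume 0 x := fun χ =>
    ((continuous_tailPrimitive χ).mul (by fun_prop)).intervalIntegrable _ _
  simp only [linCoag, Pi.add_apply, h1, tailPrimitive_add, add_mul]
  rw [intervalIntegral.integral_add (h2 φ) (h2 ψ)]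
  ring

theorem linCoag_smul (c : ℝ) (φ : 𝓓(halfLine, ℝ)) :
    linCoag (c • φ : 𝓓(halfLine, ℝ)) = c • linCoag φ := by
  funext x
  have h1 : deriv (c • φ : 𝓓(halfLine, ℝ)) x = c * deriv φ x :=
    deriv_const_mul c (φ.contDiff.differentiable (by simp) x)
  simp only [linCoag, Pi.smul_apply, smul_eq_mul, h1, tailPrimitive_smul, mul_assoc]
  rw [intervalIntegral.integral_const_mul]
  ring

theorem continuous_linCoag (φ : 𝓓(halfLine, ℝ)) : Continuous (linCoag φ) := by
  have h : linCoag φ = fun x => x * deriv φ x - 2 * tailPrimitive φ x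
      + 2 * (Real.exp (-x) * ∫ y in (0 : ℝ)..x, tailPrimitive φ y * Real.exp y) := by
    funext x
    rw [linCoag, ← intervalIntegral.integral_const_mul (Real.exp (-x))]
    congr 3
    funext y
    rw [neg_sub, sub_eq_add_neg, Real.exp_add]
    ring
  have h1 : Continuous (deriv φ) := φ.contDiff.continuous_deriv (by simp)
  have h2 := continuous_tailPrimitive φ
  have h3 : Continuous fun x => ∫ y in (0 : ℝ)..x, tailPrimitive φ y * Real.exp y :=
    intervalIntegral.continuous_primitive
      (fun a b => (h2.mul Real.continuous_exp).intervalIntegrable a b) 0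
  rw [h]
  fun_prop

/-- Outside the support of `φ` the function `L₀[φ]` is a multiple of `e^{-x}`. -/
theorem linCoag_bound (φ : 𝓓(halfLine, ℝ)) :
    ∃ C : ℝ, ∀ x ∈ Ioi (0 : ℝ), |linCoag φ x| ≤ C * Real.exp (-x) := by
  obtain ⟨R, hR0, hR⟩ : ∃ R : ℝ, 0 < R ∧ ∀ x, R ≤ x → φ x = 0 := by
    obtain ⟨R, hR⟩ := φ.hasCompactSupport.isCompact.isBounded.subset_closedBall (0 : ℝ)
    refine ⟨max R 0 + 1, by positivity, fun x hx => ?_⟩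
    by_contra hne
    have := hR (subset_tsupport _ hne)
    rw [mem_closedBall_zero_iff, Real.norm_eq_abs] at this
    have h1 := le_abs_self x
    have h2 := le_max_left R 0
    linarith
  have hH : ∀ x, R ≤ x → tailPrimitive φ x = 0 := fun x hx => by
    rw [tailPrimitive, setIntegral_congr_fun (g := fun _ => (0 : ℝ)) measurableSet_Ioi
      (fun z hz => hR z (hx.trans (le_of_lt hz)))]
    simp
  have hd : ∀ x, R < x → deriv φ x = 0 := fun x hx => by
    have : (φ : ℝ → ℝ) =ᶠ[𝓝 x] fun _ => 0 := by
      filter_upwards [Ioi_mem_nhds hx] with z hz using hR z (le_of_lt hz)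
    rw [this.deriv_eq]
    simp
  have hcont := continuous_tailPrimitive φ
  set I : ℝ := ∫ y in (0 : ℝ)..R, tailPrimitive φ y * Real.exp y with hI
  obtain ⟨M, hM⟩ := (isCompact_Icc (a := (0 : ℝ)) (b := R)).exists_bound_of_continuousOn
    (f := fun x => Real.exp x * linCoag φ x)
    (Real.continuous_exp.mul (continuous_linCoag φ)).continuousOn
  refine ⟨max M |2 * I|, fun x hx => ?_⟩
  have key : |Real.exp x * linCoag φ x| ≤ max M |2 * I| := by
    rcases le_or_gt x R with h | h
    · exact (hM x ⟨le_of_lt hx, h⟩).trans (le_max_left _ _)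
    · refine le_trans (le_of_eq ?_) (le_max_right _ _)
      congr 1
      have e1 : ∫ y in (0 : ℝ)..x, tailPrimitive φ y * Real.exp (-(x - y))
          = Real.exp (-x) * I := by
        have hint : ∀ a b, IntervalIntegrable
            (fun y => tailPrimitive φ y * Real.exp (-(x - y))) volume a b := fun a b =>
          (hcont.mul (by fun_prop)).intervalIntegrable _ _
        rw [← intervalIntegral.integral_add_adjacent_intervals (hint 0 R) (hint R x)]
        have z : ∫ y in R..x, tailPrimitive φ y * Real.exp (-(x - y)) = 0 := by
          rw [intervalIntegral.integral_congr (g := fun _ => (0 : ℝ))]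
          · simp
          · intro y hy
            rw [uIcc_of_le h.le] at hy
            simp [hH y hy.1]
        rw [z, add_zero, hI, ← intervalIntegral.integral_const_mul]
        congr 1
        funext y
        rw [neg_sub, sub_eq_add_neg, Real.exp_add]
        ring
      rw [linCoag, hd x h, hH x h.le, e1]
      have : Real.exp x * Real.exp (-x) = 1 := by rw [← Real.exp_add]; simp
      linear_combination 2 * I * this
  rw [abs_mul, abs_of_pos (Real.exp_pos x)] at key
  rw [Real.exp_neg, ← div_eq_mul_inv, le_div_iff₀ (Real.exp_pos x)]
  linarith

/-- A continuous function that is `O(e^{-x})` on the half line lies in `L²(e^{μx})` if `μ < 2`. -/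
theorem memLp_of_bound {μ : ℝ} (hμ : μ < 2) {g : ℝ → ℝ} (hg : Continuous g) {C : ℝ}
    (hC : ∀ x ∈ Ioi (0 : ℝ), |g x| ≤ C * Real.exp (-x)) : MemLp g 2 (expMeasure μ) := by
  have hm : Measurable fun x : ℝ => ENNReal.ofReal (Real.exp (μ * x)) := by fun_prop
  rw [memLp_two_iff_integrable_sq hg.aestronglyMeasurable, expMeasure,
    integrable_withDensity_iff hm (by simp)]
  have hdom : IntegrableOn (fun x => C ^ 2 * Real.exp (-(2 - μ) * x)) (Ioi (0 : ℝ)) :=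
    (integrableOn_exp_mul_Ioi (by linarith) 0).const_mul _
  refine Integrable.mono' hdom
    ((hg.measurable.pow_const 2).mul hm.ennreal_toReal).aestronglyMeasurable ?_
  filter_upwards [ae_restrict_mem measurableSet_Ioi] with x hx
  rw [ENNReal.toReal_ofReal (Real.exp_pos _).le, Real.norm_eq_abs,
    abs_of_nonneg (by positivity)]
  have e : Real.exp (-(2 - μ) * x) = Real.exp (-x) ^ 2 * Real.exp (μ * x) := by
    rw [sq, ← Real.exp_add, ← Real.exp_add]
    congr 1
    ring
  rw [e, ← mul_assoc, ← mul_pow]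
  refine mul_le_mul_of_nonneg_right ?_ (Real.exp_pos _).le
  exact sq_le_sq' (by linarith [hC x hx, neg_abs_le (g x)]) ((le_abs_self _).trans (hC x hx))

theorem memLp_linCoag {μ : ℝ} (hμ : μ < 2) (φ : 𝓓(halfLine, ℝ)) :
    MemLp (linCoag φ) 2 (expMeasure μ) :=
  memLp_of_bound hμ (continuous_linCoag φ) (linCoag_bound φ).choose_spec

theorem memLp_testFunction {μ : ℝ} (hμ : μ < 2) (φ : 𝓓(halfLine, ℝ)) :
    MemLp φ 2 (expMeasure μ) := by
  obtain ⟨C, hC⟩ := (Real.continuous_exp.mul φ.continuous).bounded_above_of_compact_support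
    (φ.hasCompactSupport.mul_left (f := Real.exp))
  refine memLp_of_bound hμ φ.continuous (C := C) fun x _ => ?_
  have := hC x
  rw [Real.norm_eq_abs, Pi.mul_apply, abs_mul, abs_of_pos (Real.exp_pos x)] at this
  rw [Real.exp_neg, ← div_eq_mul_inv, le_div_iff₀ (Real.exp_pos x)]
  linarith

end MemLp

/-- The inclusion of `C_c^∞(0, ∞)` into `L²(e^{μx})`. -/
noncomputable def testToL2 (μ : ℝ) (hμ : μ < 2) : 𝓓(halfLine, ℝ) →ₗ[ℝ] L2Exp μ where
  toFun φ := (memLp_testFunction hμ φ).toLp φ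
  map_add' φ ψ := MemLp.toLp_add (memLp_testFunction hμ φ) (memLp_testFunction hμ ψ)
  map_smul' c φ := MemLp.toLp_const_smul c (memLp_testFunction hμ φ)

theorem testToL2_injective (μ : ℝ) (hμ : μ < 2) : Function.Injective (testToL2 μ hμ) := by
  intro φ ψ h
  have hm : Measurable fun x : ℝ => ENNReal.ofReal (Real.exp (μ * x)) := by fun_prop
  have h1 : (φ : ℝ → ℝ) =ᵐ[expMeasure μ] ψ := 
    (MemLp.toLp_eq_toLp_iff (memLp_testFunction hμ φ) (memLp_testFunction hμ ψ)).1 h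
  have h2 : (φ : ℝ → ℝ) =ᵐ[volume.restrict (Ioi 0)] ψ := by
    refine Filter.EventuallyEq.filter_mono h1 (Measure.AbsolutelyContinuous.ae_le ?_)
    exact withDensity_absolutelyContinuous' hm.aemeasurable
      (Eventually.of_forall fun x => by simp [Real.exp_pos])
  have h3 : EqOn φ ψ (Ioi 0) :=
    Measure.eqOn_open_of_ae_eq h2 isOpen_Ioi φ.continuous.continuousOn ψ.continuous.continuousOn
  ext x
  by_cases hx : x ∈ Ioi (0 : ℝ)
  · exact h3 hx
  · have z : ∀ χ : 𝓓(halfLine, ℝ), χ x = 0 := fun χ =>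
      image_eq_zero_of_notMem_tsupport fun h => hx (χ.tsupport_subset h)
    rw [z φ, z ψ]

/-- `φ ↦ L₀[φ]` as a linear map from `C_c^∞(0, ∞)` to `L²(e^{μx})`. -/
noncomputable def linCoagToL2 (μ : ℝ) (hμ : μ < 2) : 𝓓(halfLine, ℝ) →ₗ[ℝ] L2Exp μ where
  toFun φ := (memLp_linCoag hμ φ).toLp (linCoag φ)
  map_add' φ ψ := by
    rw [← MemLp.toLp_add]
    exact MemLp.toLp_congr _ _ (Eventually.of_forall (congrFun (linCoag_add φ ψ)))
  map_smul' c φ := by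
    rw [RingHom.id_apply, ← MemLp.toLp_const_smul]
    exact MemLp.toLp_congr _ _ (Eventually.of_forall (congrFun (linCoag_smul c φ)))

/-- The operator `L₀` as an unbounded operator on `L²(e^{μx})` with domain `C_c^∞(0, ∞)`. -/
noncomputable def linCoagOp (μ : ℝ) (hμ : μ < 2) : L2Exp μ →ₗ.[ℝ] L2Exp μ where
  domain := LinearMap.range (testToL2 μ hμ)
  toFun := (linCoagToL2 μ hμ).comp
    (LinearEquiv.ofInjective (testToL2 μ hμ) (testToL2_injective μ hμ)).symm.toLinearMap

/-- The graph of `L₀` consists of the pairs of classes of `φ` and `L₀[φ]`,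
`φ ∈ C_c^∞(0, ∞)`. -/
theorem mem_linCoagOp_graph_iff (μ : ℝ) (hμ : μ < 2) (f g : L2Exp μ) :
    (f, g) ∈ (linCoagOp μ hμ).graph ↔
      ∃ φ : 𝓓(halfLine, ℝ), f =ᵐ[expMeasure μ] φ ∧ g =ᵐ[expMeasure μ] linCoag φ := by
  rw [LinearPMap.mem_graph_iff]
  constructor
  · rintro ⟨⟨_, φ, rfl⟩, hz, hy⟩
    have e : (LinearEquiv.ofInjective (testToL2 μ hμ) (testToL2_injective μ hμ)).symm
        ⟨testToL2 μ hμ φ, φ, rfl⟩ = φ :=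
      (LinearEquiv.symm_apply_eq _).2 rfl
    replace hz : testToL2 μ hμ φ = f := hz
    refine ⟨φ, ?_, ?_⟩
    · rw [← hz]
      exact MemLp.coeFn_toLp (memLp_testFunction hμ φ)
    · have hy' : linCoagToL2 μ hμ φ = g := by
        exact (congrArg (linCoagToL2 μ hμ) e.symm).trans hy
      rw [← hy']
      exact MemLp.coeFn_toLp (memLp_linCoag hμ φ)
  · rintro ⟨φ, hf, hg⟩
    have e : (LinearEquiv.ofInjective (testToL2 μ hμ) (testToL2_injective μ hμ)).symm
        ⟨testToL2 μ hμ φ, φ, rfl⟩ = φ :=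
      (LinearEquiv.symm_apply_eq _).2 rfl
    refine ⟨⟨testToL2 μ hμ φ, φ, rfl⟩, ?_, ?_⟩
    · exact Lp.ext ((MemLp.coeFn_toLp (memLp_testFunction hμ φ)).trans hf.symm)
    · refine Eq.trans (congrArg (linCoagToL2 μ hμ) e) ?_
      exact Lp.ext ((MemLp.coeFn_toLp (memLp_linCoag hμ φ)).trans hg.symm)

/-!
Write `D_t f = f(e^t ·)` for the dilations, `J f = ∫_x^∞ f` for the tail primitive and `V f` for the
convolution of `f` with `e^{-x}` on the half line. Then `L₀ = x ∂ₓ - 2 (1 - V) J` is a bounded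
perturbation of the generator of `D_t`, and the perturbed semigroup `T_t` is explicit: since `J` is
injective, it is determined by `J T_t = e^t M_t² D_t J` with `M_t = e^{-t} + (1 - e^{-t}) V`. The
semigroup law follows from `M_s D_s M_t = M_{s+t} D_s`, which expresses how dilations deform `V`.

On `L²(e^{μx})` the dilation `D_t` has norm at most `e^{-t/2}`, so only the term of `T_t` with
factor `e^t V D_t J` can spoil the decay. The function `V g + J g - V J g` is `∫ g` times `e^{-x}`,
so it vanishes for `g = D_t J h` if `∫ x h = 0`. Hence
`V D_t J h = -(1 - V) J D_t J h = -e^{-t} (1 - V) D_t J² h`, which absorbs the growth.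
-/

open Asymptotics

/-! ### Generators and cores -/

theorem tendsto_nnreal_slope_zero {F : Type*} [NormedAddCommGroup F] [NormedSpace ℝ F] {f : ℝ → F}
    {f' : F} (h : HasDerivAt f f' 0) :
    Tendsto (fun t : ℝ≥0 => (t : ℝ)⁻¹ • (f t - f 0)) (𝓝[>] 0) (𝓝 f') := by
  have hcoe : Tendsto ((↑) : ℝ≥0 → ℝ) (𝓝[>] 0) (𝓝[>] 0) :=
    tendsto_nhdsWithin_iff.2 ⟨NNReal.continuous_coe.continuousAt.mono_left nhdsWithin_le_nhds,
      self_mem_nhdsWithin⟩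
  simpa [Function.comp_def] using h.tendsto_slope_zero_right.comp hcoe

namespace C0Semigroup

variable {E : Type*} [NormedAddCommGroup E] [NormedSpace ℝ E] {T : C0Semigroup E}

theorem op_zero_apply (T : C0Semigroup E) (x : E) : T.op 0 x = x := by
  rw [T.op_zero, ContinuousLinearMap.id_apply]

theorem op_add_apply (T : C0Semigroup E) (s t : ℝ≥0) (x : E) :
    T.op (s + t) x = T.op s (T.op t x) := by
  rw [T.op_add, ContinuousLinearMap.comp_apply]

theorem op_comm_apply (T : C0Semigroup E) (s t : ℝ≥0) (x : E) :
    T.op s (T.op t x) = T.op t (T.op s x) := by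
  rw [← T.op_add_apply, add_comm, T.op_add_apply]

theorem continuous_orbit_toNNReal (T : C0Semigroup E) (x : E) :
    Continuous fun s : ℝ => T.op s.toNNReal x :=
  (T.continuous_orbit x).comp continuous_real_toNNReal

theorem HasGen.map_op {x y : E} (h : T.HasGen x y) (t : ℝ≥0) :
    T.HasGen (T.op t x) (T.op t y) := by
  refine (((T.op t).continuous.tendsto y).comp h).congr fun s => ?_
  simp only [Function.comp_apply, map_smul, map_sub, T.op_comm_apply t s]

theorem HasGen.hasDerivWithinAt {x y : E} (h : T.HasGen x y) {t : ℝ} (ht : 0 ≤ t) :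
    HasDerivWithinAt (fun s : ℝ => T.op s.toNNReal x) (T.op t.toNNReal y) (Ici t) t := by
  have hlim : Tendsto (fun s : ℝ => (s - t).toNNReal) (𝓝[>] t) (𝓝[>] 0) := by
    refine tendsto_nhdsWithin_iff.2 ⟨?_, ?_⟩
    · have hc : Continuous fun s : ℝ => (s - t).toNNReal := by fun_prop
      simpa using (hc.tendsto t).mono_left nhdsWithin_le_nhds
    · filter_upwards [self_mem_nhdsWithin] with s hs
      simpa using hs
  rw [← hasDerivWithinAt_Ioi_iff_Ici, hasDerivWithinAt_iff_tendsto_slope' self_notMem_Ioi]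
  refine ((h.map_op t.toNNReal).comp hlim).congr' ?_
  filter_upwards [self_mem_nhdsWithin] with s hs
  have hs' : 0 ≤ s - t := sub_nonneg.2 (le_of_lt hs)
  simp only [Function.comp_apply, slope, vsub_eq_sub]
  rw [← T.op_add_apply, ← Real.toNNReal_add hs' ht, sub_add_cancel, Real.coe_toNNReal _ hs']

theorem exists_norm_op_le [CompleteSpace E] (T : C0Semigroup E) (t : ℝ≥0) :
    ∃ M, ∀ s ≤ t, ‖T.op s‖ ≤ M := by
  obtain ⟨M, hM⟩ := banach_steinhaus (g := fun s : Iic t => T.op s) fun x => by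
    obtain ⟨C, hC⟩ := (isCompact_Icc (a := 0) (b := t)).exists_bound_of_continuousOn
      (T.continuous_orbit x).continuousOn
    exact ⟨C, fun s => hC s ⟨zero_le, s.2⟩⟩
  exact ⟨M, fun s hs => hM ⟨s, hs⟩⟩

section Integral

variable [CompleteSpace E]

theorem exists_norm_integral_orbit_le (T : C0Semigroup E) (t : ℝ≥0) :
    ∃ C, ∀ x, ‖∫ s in (0 : ℝ)..t, T.op s.toNNReal x‖ ≤ C * ‖x‖ := by
  obtain ⟨M, hM⟩ := T.exists_norm_op_le t
  refine ⟨M * t, fun x => ?_⟩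
  have hbound : ∀ s ∈ uIoc (0 : ℝ) t, ‖T.op s.toNNReal x‖ ≤ M * ‖x‖ := fun s hs =>
    (T.op _).le_of_opNorm_le
      (hM _ (Real.toNNReal_le_iff_le_coe.2 (uIoc_of_le t.2 ▸ hs).2)) x
  refine (intervalIntegral.norm_integral_le_of_norm_le_const hbound).trans_eq ?_
  rw [sub_zero, NNReal.abs_eq, mul_right_comm]

/-- The bounded operator `x ↦ ∫₀ᵗ T s x ds`. Its values lie in the domain of the generator, which
it inverts up to `T t - 1`. -/
noncomputable def orbitIntegral (T : C0Semigroup E) (t : ℝ≥0) : E →L[ℝ] E :=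
  LinearMap.mkContinuousOfExistsBound
    { toFun := fun x => ∫ s in (0 : ℝ)..t, T.op s.toNNReal x
      map_add' := fun x y => by
        simp only [map_add]
        exact intervalIntegral.integral_add
          ((T.continuous_orbit_toNNReal x).intervalIntegrable _ _)
          ((T.continuous_orbit_toNNReal y).intervalIntegrable _ _)
      map_smul' := fun c x => by
        simp only [map_smul, intervalIntegral.integral_smul, RingHom.id_apply] }
    (T.exists_norm_integral_orbit_le t)

theorem orbitIntegral_apply (T : C0Semigroup E) (t : ℝ≥0) (x : E) :
    T.orbitIntegral t x = ∫ s in (0 : ℝ)..t, T.op s.toNNReal x :=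
  rfl

theorem HasGen.op_sub_eq {x y : E} (h : T.HasGen x y) (t : ℝ≥0) :
    T.op t x - x = T.orbitIntegral t y := by
  rw [orbitIntegral_apply, intervalIntegral.integral_eq_sub_of_hasDeriv_right
    (T.continuous_orbit_toNNReal x).continuousOn
    (fun s hs => (h.hasDerivWithinAt (le_of_lt (by simpa using hs.1))).mono Ioi_subset_Ici_self)
    ((T.continuous_orbit_toNNReal y).intervalIntegrable _ _),
    Real.toNNReal_coe, Real.toNNReal_zero, op_zero_apply]

theorem tendsto_inv_smul_orbitIntegral (T : C0Semigroup E) (x : E) :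
    Tendsto (fun t : ℝ≥0 => (t : ℝ)⁻¹ • T.orbitIntegral t x) (𝓝[>] 0) (𝓝 x) := by
  have hderiv : HasDerivAt (fun t : ℝ => ∫ s in (0 : ℝ)..t, T.op s.toNNReal x) x 0 := by
    simpa [op_zero_apply] using
      intervalIntegral.integral_hasDerivAt_right (a := (0 : ℝ)) (b := 0) (by simp)
        (T.continuous_orbit_toNNReal x).aestronglyMeasurable.stronglyMeasurableAtFilter
        (T.continuous_orbit_toNNReal x).continuousAt
  simpa [orbitIntegral_apply] using tendsto_nnreal_slope_zero hderiv

theorem hasGen_iff {x y : E} : T.HasGen x y ↔ ∀ t, T.op t x - x = T.orbitIntegral t y := by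
  refine ⟨HasGen.op_sub_eq, fun h => ?_⟩
  simp only [HasGen, h]
  exact T.tendsto_inv_smul_orbitIntegral y

theorem isClosed_generator_graph (T : C0Semigroup E) :
    IsClosed (T.generator.graph : Set (E × E)) := by
  have hgraph : (T.generator.graph : Set (E × E)) =
      ⋂ t, {p | T.op t p.1 - p.1 = T.orbitIntegral t p.2} := by
    ext ⟨x, y⟩
    simp only [SetLike.mem_coe, mem_generator_graph_iff, hasGen_iff, mem_iInter, mem_ofPred_eq]
  rw [hgraph]
  exact isClosed_iInter fun t => isClosed_eq (by fun_prop) (by fun_prop)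

end Integral

end C0Semigroup

theorem intervalIntegral_mem_of_isClosed {F : Type*} [NormedAddCommGroup F] [NormedSpace ℝ F]
    [CompleteSpace F] {G : Submodule ℝ F} (hG : IsClosed (G : Set F)) {f : ℝ → F}
    (hf : Continuous f) (hmem : ∀ s, f s ∈ G) (a b : ℝ) : ∫ s in a..b, f s ∈ G := by
  have := hG.completeSpace_coe
  have hlift : Continuous fun s => (⟨f s, hmem s⟩ : G) := by fun_prop
  have := G.subtypeL.intervalIntegral_comp_comm (hlift.intervalIntegrable (μ := volume) a b)
  simp only [Submodule.subtypeL_apply] at this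
  rw [this]
  exact Submodule.coe_mem _

theorem mem_vadd_graph_iff {R E F : Type*} [Ring R] [AddCommGroup E] [Module R E] [AddCommGroup F]
    [Module R F] (B : E →ₗ[R] F) (L : E →ₗ.[R] F) (x : E) (y : F) :
    (x, y) ∈ (B +ᵥ L).graph ↔ (x, y - B x) ∈ L.graph := by
  simp only [LinearPMap.mem_graph_iff', LinearPMap.vadd_apply, Prod.mk.injEq]
  constructor
  · rintro ⟨x, rfl, rfl⟩
    exact ⟨x, rfl, (add_sub_cancel_left _ _).symm⟩
  · rintro ⟨x, rfl, h⟩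
    exact ⟨x, rfl, by rw [h, add_sub_cancel]⟩

section Generation

variable {E : Type*} [NormedAddCommGroup E] [NormedSpace ℝ E] {T D : C0Semigroup E}
  {L : E →ₗ.[ℝ] E}

theorem generates_iff : Generates L T ↔ L.graph.topologicalClosure = T.generator.graph := by
  constructor
  · rintro ⟨hcl, h⟩
    rw [hcl.graph_closure_eq_closure_graph, h]
  · intro h
    have hcl : L.IsClosable := ⟨_, h⟩
    exact ⟨hcl, LinearPMap.eq_of_eq_graph (hcl.graph_closure_eq_closure_graph.symm.trans h)⟩

theorem orbitIntegral_mem_graph_topologicalClosure [CompleteSpace E] (hle : L ≤ T.generator)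
    (hinv : ∀ x ∈ L.domain, ∀ t, T.op t x ∈ L.domain) {x : E} (hx : x ∈ L.domain) (t : ℝ≥0) :
    (T.orbitIntegral t x, T.op t x - x) ∈ L.graph.topologicalClosure := by
  have hgen : ∀ {x y}, (x, y) ∈ L.graph → T.HasGen x y := fun h =>
    (T.mem_generator_graph_iff _ _).1 (LinearPMap.le_graph_of_le hle h)
  have hLx := L.mem_graph ⟨x, hx⟩
  have horbit : ∀ s : ℝ, (T.op s.toNNReal x, T.op s.toNNReal (L ⟨x, hx⟩)) ∈ L.graph := fun s => by
    have hmem := L.mem_graph ⟨_, hinv x hx s.toNNReal⟩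
    rwa [(hgen hmem).unique ((hgen hLx).map_op s.toNNReal)] at hmem
  have hcont := (T.continuous_orbit_toNNReal x).prodMk (T.continuous_orbit_toNNReal (L ⟨x, hx⟩))
  have hint := intervalIntegral_mem_of_isClosed L.graph.isClosed_topologicalClosure hcont
    (fun s => L.graph.le_topologicalClosure (horbit s)) 0 t
  rw [(hgen hLx).op_sub_eq]
  convert hint
  · exact (ContinuousLinearMap.fst ℝ E E).intervalIntegral_comp_comm (hcont.intervalIntegrable _ _)
  · exact (ContinuousLinearMap.snd ℝ E E).intervalIntegral_comp_comm (hcont.intervalIntegrable _ _)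

theorem generates_of_dense_of_invariant [CompleteSpace E] (hle : L ≤ T.generator)
    (hdense : Dense (L.domain : Set E)) (hinv : ∀ x ∈ L.domain, ∀ t, T.op t x ∈ L.domain) :
    Generates L T := by
  rw [generates_iff]
  refine le_antisymm (L.graph.topologicalClosure_minimal (LinearPMap.le_graph_of_le hle)
    T.isClosed_generator_graph) ?_
  rintro ⟨x, y⟩ hxy
  rw [T.mem_generator_graph_iff] at hxy
  have hclosed := L.graph.isClosed_topologicalClosure
  have hmean : ∀ t, (T.orbitIntegral t x, T.op t x - x) ∈ L.graph.topologicalClosure := fun t =>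
    hdense.induction (P := fun x => (T.orbitIntegral t x, T.op t x - x) ∈ _)
      (fun z hz => orbitIntegral_mem_graph_topologicalClosure hle hinv hz t)
      (hclosed.preimage (by fun_prop)) x
  exact hclosed.mem_of_tendsto ((T.tendsto_inv_smul_orbitIntegral x).prodMk_nhds hxy)
    (Eventually.of_forall fun t => Submodule.smul_mem _ (t : ℝ)⁻¹ (hmean t))

theorem C0Semigroup.hasGen_iff_of_tendsto {B : E →L[ℝ] E}
    (h : ∀ x, Tendsto (fun t : ℝ≥0 => (t : ℝ)⁻¹ • (T.op t x - D.op t x)) (𝓝[>] 0) (𝓝 (B x)))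
    (x y : E) : T.HasGen x y ↔ D.HasGen x (y - B x) := by
  constructor
  · refine fun hT => (hT.sub (h x)).congr fun t => ?_
    rw [← smul_sub]
    congr 1
    abel
  · intro hD
    rw [← sub_add_cancel y (B x)]
    refine (Tendsto.add hD (h x)).congr fun t => ?_
    rw [← smul_add, add_comm, sub_add_sub_cancel]

theorem Generates.vadd (hL : Generates L D) (B : E →L[ℝ] E)
    (h : ∀ x, Tendsto (fun t : ℝ≥0 => (t : ℝ)⁻¹ • (T.op t x - D.op t x)) (𝓝[>] 0) (𝓝 (B x))) :
    Generates ((B : E →ₗ[ℝ] E) +ᵥ L) T := by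
  rw [generates_iff] at hL ⊢
  let shear := ((ContinuousLinearEquiv.refl ℝ E).skewProd (.refl ℝ E) B).symm
  have hgraph : (((B : E →ₗ[ℝ] E) +ᵥ L).graph : Set (E × E)) = shear ⁻¹' L.graph := by
    ext ⟨x, y⟩
    exact mem_vadd_graph_iff (B : E →ₗ[ℝ] E) L x y
  ext ⟨x, y⟩
  rw [T.mem_generator_graph_iff, C0Semigroup.hasGen_iff_of_tendsto h,
    ← D.mem_generator_graph_iff, ← hL, ← SetLike.mem_coe, Submodule.topologicalClosure_coe, hgraph,
    ← shear.preimage_closure]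
  rfl

end Generation

/-! ### Perturbed dilations -/

/-- A semigroup `dil` of operators that scale like the dilations `f ↦ f (eᵗ ·)` with respect to
an operator `tail`, modelled on `f ↦ ∫_x^∞ f`, and an operator `conv`, modelled on the convolution
with `e^{-x}` on the half line. These relations make the perturbation of the generator of `dil` by
`-2 tail + 2 conv tail` explicitly solvable. -/
structure DilationTriple (E : Type*) [NormedAddCommGroup E] [NormedSpace ℝ E] where
  dil : C0Semigroup E
  tail : E →L[ℝ] E
  conv : E →L[ℝ] E
  tail_injective : Function.Injective tail
  tail_dil : ∀ t x, tail (dil.op t x) = Real.exp (-t) • dil.op t (tail x)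
  tail_conv : ∀ x, tail (conv x) = tail x + conv x
  conv_dil : ∀ t x, conv (dil.op t x) =
    Real.exp (-t) • dil.op t (conv x) + (1 - Real.exp (-t)) • conv (dil.op t (conv x))

namespace DilationTriple

variable {E : Type*} [NormedAddCommGroup E] [NormedSpace ℝ E] (S : DilationTriple E)

/-- The interpolation `a + (1 - a) V` between the identity and `V = conv`. It describes how `conv`
is deformed by dilations, see `mix_dil_mix`. -/
noncomputable def mix (a : ℝ) : E →L[ℝ] E :=
  a • ContinuousLinearMap.id ℝ E + (1 - a) • S.conv

theorem mix_apply (a : ℝ) (x : E) : S.mix a x = a • x + (1 - a) • S.conv x :=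
  rfl

theorem mix_comm (a b : ℝ) (x : E) : S.mix a (S.mix b x) = S.mix b (S.mix a x) := by
  simp only [mix_apply, map_add, map_smul]
  module

theorem mix_dil_mix (t : ℝ≥0) (b : ℝ) (x : E) :
    S.mix (Real.exp (-t)) (S.dil.op t (S.mix b x)) = S.mix (Real.exp (-t) * b) (S.dil.op t x) := by
  simp only [mix_apply, map_add, map_smul, S.conv_dil t x]
  module

/-- The complementary convolution `1 - conv`. -/
noncomputable def coConv : E →L[ℝ] E :=
  ContinuousLinearMap.id ℝ E - S.conv

theorem coConv_apply (x : E) : S.coConv x = x - S.conv x :=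
  rfl

theorem tail_coConv (x : E) : S.tail (S.coConv x) = -S.conv x := by
  rw [coConv_apply, map_sub, S.tail_conv, sub_add_cancel_left]

/-- The perturbed dilation at time `t`. After applying `tail` it becomes `eᵗ M² dil tail` with
`M = mix e^{-t}`, see `tail_op`; the formula solves this for the operator itself. -/
noncomputable def op (t : ℝ≥0) : E →L[ℝ] E :=
  S.dil.op t - (1 - Real.exp (-t)) • S.coConv ∘L
    ((2 : ℝ) • ContinuousLinearMap.id ℝ E + (Real.exp t - 1) • S.conv) ∘L S.dil.op t ∘L S.tail

theorem op_apply (t : ℝ≥0) (x : E) :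
    S.op t x = S.dil.op t x - (1 - Real.exp (-t)) • S.coConv ((2 : ℝ) • S.dil.op t (S.tail x) +
      (Real.exp t - 1) • S.conv (S.dil.op t (S.tail x))) :=
  rfl

theorem tail_op (t : ℝ≥0) (x : E) :
    S.tail (S.op t x) = Real.exp t •
      S.mix (Real.exp (-t)) (S.mix (Real.exp (-t)) (S.dil.op t (S.tail x))) := by
  have hexp : Real.exp (-t) = (Real.exp t)⁻¹ := Real.exp_neg t
  have hpos := (Real.exp_pos t).ne'
  simp only [op_apply, mix_apply, map_sub, map_add, map_smul, tail_coConv, S.tail_dil, hexp]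
  match_scalars <;> field_simp
  ring

theorem op_add_apply (s t : ℝ≥0) (x : E) : S.op (s + t) x = S.op s (S.op t x) := by
  apply S.tail_injective
  have hexp : Real.exp (-↑(s + t)) = Real.exp (-s) * Real.exp (-t) := by
    rw [← Real.exp_add, NNReal.coe_add, neg_add]
  calc S.tail (S.op (s + t) x)
      = (Real.exp s * Real.exp t) • S.mix (Real.exp (-s) * Real.exp (-t))
          (S.mix (Real.exp (-s) * Real.exp (-t)) (S.dil.op s (S.dil.op t (S.tail x)))) := by
        rw [tail_op, hexp, NNReal.coe_add, Real.exp_add, S.dil.op_add_apply]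
    _ = (Real.exp s * Real.exp t) • S.mix (Real.exp (-s)) (S.mix (Real.exp (-s)) (S.dil.op s
          (S.mix (Real.exp (-t)) (S.mix (Real.exp (-t)) (S.dil.op t (S.tail x)))))) := by
        rw [mix_dil_mix, S.mix_comm (Real.exp (-s)), mix_dil_mix]
    _ = S.tail (S.op s (S.op t x)) := by
        rw [tail_op, tail_op, map_smul, map_smul, map_smul, smul_smul]

/-- The semigroup obtained from `dil` by adding `perturbation` to its generator. -/
noncomputable def semigroup : C0Semigroup E where
  op := S.op
  op_zero := by
    ext x
    simp [op_apply, S.dil.op_zero_apply]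
  op_add s t := ContinuousLinearMap.ext (S.op_add_apply s t)
  continuous_orbit x := by
    have hx := S.dil.continuous_orbit x
    have htail := S.dil.continuous_orbit (S.tail x)
    simp only [op_apply]
    fun_prop

/-- The bounded operator `-2 tail + 2 conv tail`. -/
noncomputable def perturbation : E →L[ℝ] E :=
  -(2 : ℝ) • S.coConv ∘L S.tail

theorem perturbation_apply (x : E) : S.perturbation x = -(2 : ℝ) • S.coConv (S.tail x) :=
  rfl

theorem tendsto_slope_semigroup_sub_dil (x : E) :
    Tendsto (fun t : ℝ≥0 => (t : ℝ)⁻¹ • (S.semigroup.op t x - S.dil.op t x)) (𝓝[>] 0)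
      (𝓝 (S.perturbation x)) := by
  have hderiv : HasDerivAt (fun t : ℝ => Real.exp (-t)) (-1) 0 := by
    simpa using (hasDerivAt_neg (0 : ℝ)).exp
  have hslope : Tendsto (fun t : ℝ≥0 => (t : ℝ)⁻¹ * (Real.exp (-t) - 1)) (𝓝[>] 0) (𝓝 (-1)) := by
    simpa using tendsto_nnreal_slope_zero hderiv
  have htail := S.dil.continuous_orbit (S.tail x)
  have hcont : Continuous fun t : ℝ≥0 => S.coConv ((2 : ℝ) • S.dil.op t (S.tail x) +
      (Real.exp t - 1) • S.conv (S.dil.op t (S.tail x))) := by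
    fun_prop
  have hlim := hslope.smul ((hcont.tendsto 0).mono_left nhdsWithin_le_nhds)
  rw [NNReal.coe_zero, Real.exp_zero, sub_self, zero_smul, add_zero, S.dil.op_zero_apply,
    map_smul, smul_smul, neg_one_mul, ← perturbation_apply] at hlim
  refine hlim.congr fun t => ?_
  rw [mul_smul, semigroup, op_apply, sub_sub_cancel_left, ← neg_smul, neg_sub]

theorem generates_semigroup {L : E →ₗ.[ℝ] E} (hL : Generates L S.dil) :
    Generates ((S.perturbation : E →ₗ[ℝ] E) +ᵥ L) S.semigroup :=
  hL.vadd S.perturbation S.tendsto_slope_semigroup_sub_dil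

/-- The operator `conv + tail - conv tail`. For functions on the half line its values are the
multiples of `e^{-x}` by the integral. -/
noncomputable def defect : E →L[ℝ] E :=
  S.conv + S.tail - S.conv ∘L S.tail

theorem defect_apply (x : E) : S.defect x = S.conv x + S.tail x - S.conv (S.tail x) :=
  rfl

theorem defect_dil (t : ℝ≥0) (x : E) :
    S.defect (S.dil.op t x) = S.mix (Real.exp (-t)) (S.dil.op t (S.defect x)) := by
  simp only [defect_apply, mix_apply, map_add, map_sub, map_smul, S.tail_dil, S.conv_dil t x,
    S.conv_dil t (S.tail x)]
  module

/-- If the defect vanishes, the growing term `(eᵗ - 1) conv` is turned into a bounded one. -/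
theorem op_apply_of_defect_eq_zero {x : E} (hx : S.defect (S.tail x) = 0) (t : ℝ≥0) :
    S.op t x = S.dil.op t x - (2 * (1 - Real.exp (-t))) • S.coConv (S.dil.op t (S.tail x)) +
      (1 - Real.exp (-t)) ^ 2 • S.coConv (S.coConv (S.dil.op t (S.tail (S.tail x)))) := by
  have hdefect : S.defect (S.dil.op t (S.tail x)) = 0 := by
    rw [defect_dil, hx, map_zero, map_zero]
  have hconv : S.conv (S.dil.op t (S.tail x)) =
      -(Real.exp (-t) • S.coConv (S.dil.op t (S.tail (S.tail x)))) := by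
    rw [← map_smul, ← S.tail_dil, coConv_apply, ← sub_eq_zero, ← hdefect, defect_apply]
    abel
  have hexp : Real.exp t * Real.exp (-t) = 1 := by
    rw [← Real.exp_add, add_neg_cancel, Real.exp_zero]
  rw [op_apply, hconv, map_add, map_smul, map_smul, map_neg, map_smul]
  match_scalars
  · ring
  · ring
  · linear_combination (1 - Real.exp (-t)) * hexp

theorem norm_op_apply_le {x : E} (hx : S.defect (S.tail x) = 0) (t : ℝ≥0) :
    ‖S.op t x‖ ≤ (1 + ‖S.coConv‖ * ‖S.tail‖) ^ 2 * ‖S.dil.op t‖ * ‖x‖ := by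
  set k := ‖S.coConv‖
  set j := ‖S.tail‖
  set d := ‖S.dil.op t‖
  have ha : 0 ≤ 1 - Real.exp (-t) := sub_nonneg.2 (Real.exp_le_one_iff.2 (neg_nonpos.2 t.2))
  have ha' : 1 - Real.exp (-t) ≤ 1 := sub_le_self 1 (Real.exp_pos _).le
  have hj := S.tail.le_opNorm x
  have hj₂ := S.tail.le_opNorm_of_le hj
  have hfst : ‖S.dil.op t x‖ ≤ d * ‖x‖ := (S.dil.op t).le_opNorm x
  have hsnd : ‖S.coConv (S.dil.op t (S.tail x))‖ ≤ k * (d * (j * ‖x‖)) :=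
    S.coConv.le_opNorm_of_le ((S.dil.op t).le_opNorm_of_le hj)
  have hthd : ‖S.coConv (S.coConv (S.dil.op t (S.tail (S.tail x))))‖ ≤
      k * (k * (d * (j * (j * ‖x‖)))) :=
    S.coConv.le_opNorm_of_le (S.coConv.le_opNorm_of_le ((S.dil.op t).le_opNorm_of_le hj₂))
  rw [S.op_apply_of_defect_eq_zero hx]
  refine (norm_add_le_of_le (norm_sub_le_of_le hfst (?_ : _ ≤ 2 * (k * (d * (j * ‖x‖)))))
    (?_ : _ ≤ k * (k * (d * (j * (j * ‖x‖)))))).trans_eq (by ring)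
  · rw [norm_smul, Real.norm_of_nonneg (by positivity)]
    gcongr
    linarith
  · rw [norm_smul, Real.norm_of_nonneg (by positivity)]
    exact (mul_le_of_le_one_left (norm_nonneg _) (pow_le_one₀ ha ha')).trans hthd

end DilationTriple

/-! ### Continuous functions of exponential decay -/

/-- The space of continuous functions on the line that are `O(e^{-bx})` on the half line `x ≥ 0`;
a negative rate `b` allows exponential growth. -/
def expDecay (b : ℝ) : Submodule ℝ (ℝ → ℝ) where
  carrier := {f | Continuous f ∧ f =O[𝓟 (Ici 0)] fun x => Real.exp (-b * x)}
  zero_mem' := ⟨continuous_const, isBigO_zero _ _⟩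
  add_mem' hf hg := ⟨hf.1.add hg.1, hf.2.add hg.2⟩
  smul_mem' c _ hf := ⟨hf.1.const_smul c, hf.2.const_smul_left c⟩

namespace expDecay

variable {b c : ℝ} {f g : ℝ → ℝ}

theorem exists_bound (hf : f ∈ expDecay b) :
    ∃ C, 0 ≤ C ∧ ∀ x, 0 ≤ x → |f x| ≤ C * Real.exp (-b * x) := by
  obtain ⟨C, hC⟩ := isBigO_principal.1 hf.2
  have h (x : ℝ) (hx : 0 ≤ x) : |f x| ≤ C * Real.exp (-b * x) := by
    simpa only [Real.norm_eq_abs, Real.abs_exp] using hC x hx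
  exact ⟨C, by simpa using (abs_nonneg _).trans (h 0 le_rfl), h⟩

theorem mem_of_bound (hf : Continuous f) {C : ℝ}
    (hC : ∀ x, 0 ≤ x → |f x| ≤ C * Real.exp (-b * x)) : f ∈ expDecay b :=
  ⟨hf, isBigO_principal.2 ⟨C, fun x hx => by
    simpa only [Real.norm_eq_abs, Real.abs_exp] using hC x hx⟩⟩

theorem antitone : Antitone expDecay := fun b c hbc f hf => by
  obtain ⟨C, hC0, hC⟩ := exists_bound hf
  refine mem_of_bound hf.1 (C := C) fun x hx => (hC x hx).trans ?_
  gcongr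

theorem mul_mem (hf : f ∈ expDecay b) (hg : g ∈ expDecay c) :
    (fun x => f x * g x) ∈ expDecay (b + c) := by
  refine ⟨hf.1.mul hg.1, (hf.2.mul hg.2).congr_right fun x => ?_⟩
  rw [← Real.exp_add]
  ring_nf

theorem exp_mem (b : ℝ) : (fun x => Real.exp (-b * x)) ∈ expDecay b :=
  ⟨by fun_prop, isBigO_refl _ _⟩

theorem id_mem {ε : ℝ} (hε : 0 < ε) : (fun x => x) ∈ expDecay (-ε) := by
  refine mem_of_bound continuous_id (C := ε⁻¹) fun x hx => ?_
  rw [abs_of_nonneg hx, neg_neg, inv_mul_eq_div, le_div_iff₀ hε]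
  linarith [Real.add_one_le_exp (ε * x)]

theorem const_mem (a : ℝ) : (fun _ => a) ∈ expDecay 0 :=
  mem_of_bound continuous_const (C := |a|) (by simp)

theorem mem_of_hasCompactSupport (hf : Continuous f) (hs : HasCompactSupport f) (b : ℝ) :
    f ∈ expDecay b := by
  obtain ⟨C, hC⟩ := Continuous.bounded_above_of_compact_support
    (f := fun x => Real.exp (b * x) * f x) (.mul (by fun_prop) hf)
    (hs.mul_left (f := fun x => Real.exp (b * x)))
  refine mem_of_bound hf (C := C) fun x _ => ?_
  have h := hC x
  rwa [norm_mul, Real.norm_eq_abs, Real.norm_eq_abs, Real.abs_exp, mul_comm,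
    ← le_div_iff₀ (Real.exp_pos _), div_eq_mul_inv, ← Real.exp_neg, ← neg_mul] at h

theorem integrableOn_Ioi (hb : 0 < b) (hf : f ∈ expDecay b) (a : ℝ) : IntegrableOn f (Ioi a) := by
  obtain ⟨C, -, hC⟩ := exists_bound hf
  have hzero : IntegrableOn f (Ioi 0) := by
    refine Integrable.mono' ((integrableOn_exp_mul_Ioi (neg_lt_zero.2 hb) 0).const_mul C)
      hf.1.aestronglyMeasurable ?_
    filter_upwards [ae_restrict_mem measurableSet_Ioi] with x hx using hC x (le_of_lt hx)
  exact ((hf.1.integrableOn_Ioc (a := a) (b := 0)).union hzero).mono_set Ioi_subset_Ioc_union_Ioi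

theorem tendsto_zero (hb : 0 < b) (hf : f ∈ expDecay b) : Tendsto f atTop (𝓝 0) := by
  have hexp : Tendsto (fun x : ℝ => Real.exp (-b * x)) atTop (𝓝 0) :=
    Real.tendsto_exp_atBot.comp (tendsto_id.const_mul_atTop_of_neg (neg_lt_zero.2 hb))
  exact (hf.2.mono (le_principal_iff.2 (Ici_mem_atTop 0))).trans_tendsto hexp

theorem exists_bound_comp_mul_left (hb : 0 ≤ b) (hf : f ∈ expDecay b) :
    ∃ C, ∀ a, 1 ≤ a → ∀ x, 0 ≤ x → |f (a * x)| ≤ C * Real.exp (-b * x) := by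
  obtain ⟨C, hC0, hC⟩ := exists_bound hf
  refine ⟨C, fun a ha x hx => (hC _ (by positivity)).trans ?_⟩
  gcongr ?_ * ?_
  rw [Real.exp_le_exp, neg_mul, neg_mul, neg_le_neg_iff]
  exact mul_le_mul_of_nonneg_left (le_mul_of_one_le_left hx ha) hb

theorem comp_mul_left_mem (hb : 0 ≤ b) (hf : f ∈ expDecay b) {a : ℝ} (ha : 1 ≤ a) :
    (fun x => f (a * x)) ∈ expDecay b :=
  let ⟨_, hC⟩ := exists_bound_comp_mul_left hb hf
  mem_of_bound (hf.1.comp (by fun_prop)) (hC a ha)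

theorem integral_deriv_mul_add_mul_deriv {u u' v v' : ℝ → ℝ} (hbc : 0 < b + c)
    (hu : u ∈ expDecay b) (hu' : u' ∈ expDecay b) (hv : v ∈ expDecay c) (hv' : v' ∈ expDecay c)
    (hud : ∀ x, HasDerivAt u (u' x) x) (hvd : ∀ x, HasDerivAt v (v' x) x) :
    ∫ x in Ioi 0, (u' x * v x + u x * v' x) = -(u 0 * v 0) := by
  rw [integral_Ioi_of_hasDerivAt_of_tendsto' (fun x _ => (hud x).mul (hvd x))
    (integrableOn_Ioi hbc (add_mem (mul_mem hu' hv) (mul_mem hu hv')) 0)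
    (tendsto_zero hbc (mul_mem hu hv)), zero_sub]
  rfl

theorem hasDerivAt_tailPrimitive (hb : 0 < b) (hf : f ∈ expDecay b) (x : ℝ) :
    HasDerivAt (tailPrimitive f) (-f x) x := by
  have h : tailPrimitive f = fun x => (∫ z in Ioi 0, f z) - ∫ z in (0 : ℝ)..x, f z := by
    funext x
    rw [tailPrimitive, ← intervalIntegral.integral_interval_add_Ioi
      (integrableOn_Ioi hb hf 0) (integrableOn_Ioi hb hf x), add_sub_cancel_left]
  rw [h]
  exact (hf.1.integral_hasStrictDerivAt 0 x).hasDerivAt.const_sub _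

theorem tailPrimitive_mem (hb : 0 < b) (hf : f ∈ expDecay b) : tailPrimitive f ∈ expDecay b := by
  obtain ⟨C, -, hC⟩ := exists_bound hf
  refine mem_of_bound (C := C / b) (continuous_iff_continuousAt.2 fun x =>
    (hasDerivAt_tailPrimitive hb hf x).continuousAt) fun x hx => ?_
  calc |tailPrimitive f x| ≤ ∫ z in Ioi x, C * Real.exp (-b * z) := by
        rw [← Real.norm_eq_abs]
        refine norm_integral_le_of_norm_le
          ((integrableOn_exp_mul_Ioi (neg_lt_zero.2 hb) x).const_mul C)
          ((ae_restrict_mem measurableSet_Ioi).mono fun z hz => ?_)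
        exact hC z (hx.trans (le_of_lt hz))
    _ = C / b * Real.exp (-b * x) := by
        rw [integral_const_mul, integral_exp_mul_Ioi (neg_lt_zero.2 hb)]
        ring

end expDecay

/-- The convolution `∫_0^x f(y) e^{-(x-y)} dy` of `f` with the exponential, the solution of
`u' + u = f`, `u 0 = 0`. -/
noncomputable def expConv (f : ℝ → ℝ) (x : ℝ) : ℝ :=
  ∫ y in (0 : ℝ)..x, f y * Real.exp (-(x - y))

theorem expConv_zero_right (f : ℝ → ℝ) : expConv f 0 = 0 :=
  intervalIntegral.integral_same

theorem expConv_eq (f : ℝ → ℝ) (x : ℝ) :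
    expConv f x = Real.exp (-x) * ∫ y in (0 : ℝ)..x, f y * Real.exp y := by
  rw [expConv, ← intervalIntegral.integral_const_mul]
  congr 1
  funext y
  rw [neg_sub, sub_eq_add_neg, Real.exp_add]
  ring

theorem expConv_add {f g : ℝ → ℝ} (hf : Continuous f) (hg : Continuous g) :
    expConv (f + g) = expConv f + expConv g := by
  funext x
  simp only [expConv, Pi.add_apply, add_mul]
  exact intervalIntegral.integral_add
    ((hf.mul (by fun_prop)).intervalIntegrable _ _) ((hg.mul (by fun_prop)).intervalIntegrable _ _)

theorem expConv_smul (c : ℝ) (f : ℝ → ℝ) : expConv (c • f) = c • expConv f := by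
  funext x
  simp only [expConv, Pi.smul_apply, smul_eq_mul, mul_assoc]
  exact intervalIntegral.integral_const_mul _ _

theorem hasDerivAt_expConv {f : ℝ → ℝ} (hf : Continuous f) (x : ℝ) :
    HasDerivAt (expConv f) (f x - expConv f x) x := by
  have hprim : HasDerivAt (fun x => ∫ y in (0 : ℝ)..x, f y * Real.exp y) (f x * Real.exp x) x :=
    ((hf.mul Real.continuous_exp).integral_hasStrictDerivAt 0 x).hasDerivAt
  rw [funext (expConv_eq f)]
  refine ((hasDerivAt_neg x).exp.mul hprim).congr_deriv ?_
  have : Real.exp (-x) * Real.exp x = 1 := by rw [← Real.exp_add, neg_add_cancel, Real.exp_zero]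
  linear_combination f x * this

theorem expConv_eq_sub_of_hasDerivAt {u g : ℝ → ℝ} (hg : Continuous g)
    (hu : ∀ x, HasDerivAt u (g x - u x) x) (x : ℝ) :
    expConv g x = u x - u 0 * Real.exp (-x) := by
  have hderiv (y : ℝ) : HasDerivAt (fun y => u y * Real.exp y) (g y * Real.exp y) y :=
    ((hu y).mul (Real.hasDerivAt_exp y)).congr_deriv (by ring)
  rw [expConv_eq, intervalIntegral.integral_eq_sub_of_hasDerivAt (fun y _ => hderiv y)
    ((hg.mul Real.continuous_exp).intervalIntegrable _ _), Real.exp_zero]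
  have : Real.exp (-x) * Real.exp x = 1 := by rw [← Real.exp_add, neg_add_cancel, Real.exp_zero]
  linear_combination u x * this

theorem expDecay.expConv_mem {b : ℝ} (hb : b < 1) {f : ℝ → ℝ} (hf : f ∈ expDecay b) :
    expConv f ∈ expDecay b := by
  obtain ⟨C, hC0, hC⟩ := exists_bound hf
  have hb' : 0 < 1 - b := sub_pos.2 hb
  refine mem_of_bound (C := C / (1 - b)) (continuous_iff_continuousAt.2 fun x =>
    (hasDerivAt_expConv hf.1 x).continuousAt) fun x hx => ?_
  have hprim : |∫ y in (0 : ℝ)..x, f y * Real.exp y| ≤ C / (1 - b) * Real.exp ((1 - b) * x) :=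
    calc |∫ y in (0 : ℝ)..x, f y * Real.exp y| ≤ ∫ y in (0 : ℝ)..x, C * Real.exp ((1 - b) * y) := by
          have hcont : Continuous fun y : ℝ => C * Real.exp ((1 - b) * y) := by fun_prop
          rw [← Real.norm_eq_abs]
          refine intervalIntegral.norm_integral_le_of_norm_le hx
            (Eventually.of_forall fun y hy => ?_) (hcont.intervalIntegrable 0 x)
          rw [norm_mul, Real.norm_eq_abs, Real.norm_eq_abs, Real.abs_exp, sub_mul, one_mul,
            sub_eq_neg_add, ← neg_mul, Real.exp_add, ← mul_assoc]
          gcongr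
          exact hC y hy.1.le
      _ = C / (1 - b) * (Real.exp ((1 - b) * x) - 1) := by
          rw [intervalIntegral.integral_const_mul,
            intervalIntegral.integral_comp_mul_left Real.exp hb'.ne', integral_exp, mul_zero,
            Real.exp_zero, smul_eq_mul]
          ring
      _ ≤ C / (1 - b) * Real.exp ((1 - b) * x) := by
          gcongr
          linarith
  rw [expConv_eq, abs_mul, Real.abs_exp]
  calc Real.exp (-x) * |∫ y in (0 : ℝ)..x, f y * Real.exp y|
      ≤ Real.exp (-x) * (C / (1 - b) * Real.exp ((1 - b) * x)) := by gcongr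
    _ = C / (1 - b) * Real.exp (-b * x) := by
        rw [mul_left_comm, ← Real.exp_add]
        ring_nf

/-- The continuous functions that are `O(e^{-bx})` on the half line for every `b < 1`. This core
contains `C_c^∞(0, ∞)` and `e^{-x}`, it embeds into `L²(e^{μx})` for every `μ < 2`, and it is stable
under dilations, tail primitives and convolution with the exponential. -/
def decayCore : Submodule ℝ (ℝ → ℝ) := ⨅ b ∈ Ioo (0 : ℝ) 1, expDecay b

theorem mem_decayCore_iff {f : ℝ → ℝ} : f ∈ decayCore ↔ ∀ b ∈ Ioo (0 : ℝ) 1, f ∈ expDecay b := by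
  simp only [decayCore, Submodule.mem_iInf]

theorem exists_mem_Ioo_lt_two_mul {μ : ℝ} (hμ : μ < 2) : ∃ b ∈ Ioo (0 : ℝ) 1, μ < 2 * b := by
  obtain ⟨b, hb, hb1⟩ := exists_between (max_lt (by linarith : μ / 2 < 1) one_pos)
  exact ⟨b, ⟨(le_max_right _ _).trans_lt hb, hb1⟩,
    (div_lt_iff₀' two_pos).1 ((le_max_left _ _).trans_lt hb)⟩

namespace decayCore

theorem continuous (f : decayCore) : Continuous f.1 :=
  (mem_decayCore_iff.1 f.2 (1 / 2) (by norm_num)).1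

theorem integrableOn_Ioi (f : decayCore) (a : ℝ) : IntegrableOn f.1 (Ioi a) :=
  expDecay.integrableOn_Ioi one_half_pos (mem_decayCore_iff.1 f.2 (1 / 2) (by norm_num)) a

theorem tendsto_zero (f : decayCore) : Tendsto f.1 atTop (𝓝 0) :=
  expDecay.tendsto_zero one_half_pos (mem_decayCore_iff.1 f.2 (1 / 2) (by norm_num))

/-- The function `e^{-x}`. -/
noncomputable def expNeg : decayCore :=
  ⟨fun x => Real.exp (-x), mem_decayCore_iff.2 fun b hb =>
    expDecay.antitone hb.2.le (by simpa only [neg_one_mul] using expDecay.exp_mem 1)⟩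

/-- The tail primitive `x ↦ ∫_x^∞ f` on the core. -/
noncomputable def tail : decayCore →ₗ[ℝ] decayCore where
  toFun f := ⟨tailPrimitive f, mem_decayCore_iff.2 fun b hb =>
    expDecay.tailPrimitive_mem hb.1 (mem_decayCore_iff.1 f.2 b hb)⟩
  map_add' f g := Subtype.ext <| funext fun x =>
    integral_add (integrableOn_Ioi f x) (integrableOn_Ioi g x)
  map_smul' c _ := Subtype.ext <| funext fun _ => integral_const_mul c _

/-- Convolution with the exponential on the core. -/
noncomputable def conv : decayCore →ₗ[ℝ] decayCore where
  toFun f := ⟨expConv f, mem_decayCore_iff.2 fun b hb =>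
    expDecay.expConv_mem hb.2 (mem_decayCore_iff.1 f.2 b hb)⟩
  map_add' f g := Subtype.ext (expConv_add (continuous f) (continuous g))
  map_smul' c f := Subtype.ext (expConv_smul c f)

/-- The dilation `f ↦ f(e^t ·)` on the core. -/
noncomputable def dil (t : ℝ≥0) : decayCore →ₗ[ℝ] decayCore where
  toFun f := ⟨fun x => f.1 (Real.exp t * x), mem_decayCore_iff.2 fun b hb =>
    expDecay.comp_mul_left_mem hb.1.le (mem_decayCore_iff.1 f.2 b hb) (Real.one_le_exp t.2)⟩
  map_add' _ _ := rfl
  map_smul' _ _ := rfl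

theorem dil_zero (f : decayCore) : dil 0 f = f :=
  Subtype.ext <| funext fun x => congrArg f.1 <| by rw [NNReal.coe_zero, Real.exp_zero, one_mul]

theorem dil_add (s t : ℝ≥0) (f : decayCore) : dil (s + t) f = dil s (dil t f) :=
  Subtype.ext <| funext fun x => congrArg f.1 <| by
    rw [NNReal.coe_add, add_comm, Real.exp_add, mul_assoc]

theorem hasDerivAt_tail (f : decayCore) (x : ℝ) : HasDerivAt (tail f).1 (-f.1 x) x :=
  expDecay.hasDerivAt_tailPrimitive one_half_pos
    (mem_decayCore_iff.1 f.2 (1 / 2) (by norm_num)) x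

theorem hasDerivAt_conv (f : decayCore) (x : ℝ) :
    HasDerivAt (conv f).1 (f.1 x - (conv f).1 x) x :=
  hasDerivAt_expConv (continuous f) x

theorem hasDerivAt_dil {f : decayCore} {f' : ℝ → ℝ} (h : ∀ x, HasDerivAt f.1 (f' x) x)
    (t : ℝ≥0) (x : ℝ) : HasDerivAt (dil t f).1 (f' (Real.exp t * x) * Real.exp t) x :=
  HasDerivAt.comp (h₂ := f.1) (h := fun y => Real.exp t * y) x (h _)
    (((hasDerivAt_id x).const_mul (Real.exp t)).congr_deriv (mul_one _))

theorem tail_eq_of_hasDerivAt {u f : decayCore} (h : ∀ x, HasDerivAt u.1 (-f.1 x) x) :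
    tail f = u := by
  refine Subtype.ext (funext fun x => ?_)
  have hint := integral_Ioi_of_hasDerivAt_of_tendsto' (fun y _ => h y)
    (integrableOn_Ioi f x).neg (tendsto_zero u)
  rw [integral_neg, zero_sub] at hint
  exact neg_injective hint

theorem conv_eq_of_hasDerivAt {u f : decayCore} (h : ∀ x, HasDerivAt u.1 (f.1 x - u.1 x) x) :
    conv f = u - u.1 0 • expNeg :=
  Subtype.ext (funext (expConv_eq_sub_of_hasDerivAt (continuous f) h))

theorem tail_conv (f : decayCore) : tail (conv f) = tail f + conv f :=
  tail_eq_of_hasDerivAt fun x =>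
    ((hasDerivAt_tail f x).add (hasDerivAt_conv f x)).congr_deriv (by ring)

theorem tail_dil (t : ℝ≥0) (f : decayCore) :
    tail (dil t f) = Real.exp (-t) • dil t (tail f) := by
  refine tail_eq_of_hasDerivAt fun x => ?_
  refine ((hasDerivAt_dil (hasDerivAt_tail f) t x).const_mul (Real.exp (-t))).congr_deriv ?_
  rw [mul_left_comm, ← Real.exp_add, neg_add_cancel, Real.exp_zero, mul_one]
  rfl

theorem conv_dil (t : ℝ≥0) (f : decayCore) :
    conv (dil t f) = Real.exp (-t) • dil t (conv f) +
      (1 - Real.exp (-t)) • conv (dil t (conv f)) := by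
  have hconv : conv (Real.exp t • dil t f + (1 - Real.exp t) • dil t (conv f)) =
      dil t (conv f) := by
    rw [conv_eq_of_hasDerivAt (u := dil t (conv f)) fun x =>
      (hasDerivAt_dil (hasDerivAt_conv f) t x).congr_deriv ?_]
    · have hzero : (dil t (conv f)).1 0 = 0 :=
        (congrArg (expConv f) (mul_zero _)).trans (expConv_zero_right f)
      rw [hzero, zero_smul, sub_zero]
    · change (f.1 (Real.exp t * x) - (conv f).1 (Real.exp t * x)) * Real.exp t =
        Real.exp t * f.1 (Real.exp t * x) + (1 - Real.exp t) * (conv f).1 (Real.exp t * x) -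
          (conv f).1 (Real.exp t * x)
      ring
  have hexp : Real.exp (-t) * Real.exp t = 1 := by
    rw [← Real.exp_add, neg_add_cancel, Real.exp_zero]
  have hscaled := congrArg (Real.exp (-t) • ·) hconv
  simp only [map_add, map_smul, smul_add, smul_smul, mul_sub, mul_one, hexp, one_smul] at hscaled
  rw [← hscaled]
  module

theorem conv_add_tail_sub_conv_tail (f : decayCore) :
    conv f + tail f - conv (tail f) = (∫ x in Ioi 0, f.1 x) • expNeg := by
  have h := conv_eq_of_hasDerivAt (u := tail f) (f := tail f - f) fun x =>
    (hasDerivAt_tail f x).congr_deriv (sub_sub_cancel_left _ _).symm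
  rw [map_sub, sub_eq_iff_eq_add] at h
  rw [h, sub_add_eq_add_sub, add_comm (tail f), sub_sub_cancel]
  rfl

theorem integral_tail (f : decayCore) :
    ∫ x in Ioi 0, (tail f).1 x = ∫ x in Ioi 0, x * f.1 x := by
  have hmem (g : decayCore) : g.1 ∈ expDecay (1 / 2) :=
    mem_decayCore_iff.1 g.2 (1 / 2) (by norm_num)
  have hid : (fun x => x) ∈ expDecay (-(1 / 4)) := expDecay.id_mem (by norm_num)
  have hone : (fun _ => 1) ∈ expDecay (-(1 / 4)) :=
    expDecay.antitone (by norm_num) (expDecay.const_mem 1)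
  have hparts := expDecay.integral_deriv_mul_add_mul_deriv (by norm_num) (hmem (tail f))
    (neg_mem (hmem f)) hid hone (hasDerivAt_tail f) hasDerivAt_id
  have hint : IntegrableOn (fun x => x * f.1 x) (Ioi 0) :=
    expDecay.integrableOn_Ioi (b := -(1 / 4) + 1 / 2) (by norm_num)
      (expDecay.mul_mem hid (hmem f)) 0
  rw [mul_zero, neg_zero] at hparts
  refine sub_eq_zero.1 (Eq.trans ?_ hparts)
  rw [← integral_sub (integrableOn_Ioi (tail f) 0) hint]
  refine integral_congr_ae (Eventually.of_forall fun x => ?_)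
  simp only [Pi.neg_apply]
  ring

theorem integral_mul_exp_of_hasDerivAt {μ : ℝ} (hμ : μ < 2) {u u' v v' : decayCore}
    (hu : ∀ x, HasDerivAt u.1 (u'.1 x) x) (hv : ∀ x, HasDerivAt v.1 (v'.1 x) x) :
    ∫ x in Ioi 0, (u'.1 x * v.1 x + u.1 x * v'.1 x + μ * (u.1 x * v.1 x)) * Real.exp (μ * x) =
      -(u.1 0 * v.1 0) := by
  obtain ⟨b, hb, hμb⟩ := exists_mem_Ioo_lt_two_mul hμ
  have hmem (g : decayCore) : g.1 ∈ expDecay b := mem_decayCore_iff.1 g.2 b hb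
  have hexp : (fun x => Real.exp (μ * x)) ∈ expDecay (-μ) := by
    simpa only [neg_neg] using expDecay.exp_mem (-μ)
  have hexp' (x : ℝ) : HasDerivAt (fun x => Real.exp (μ * x)) (Real.exp (μ * x) * μ) x := by
    simpa using ((hasDerivAt_id x).const_mul μ).exp
  have hparts := expDecay.integral_deriv_mul_add_mul_deriv (c := b + -μ) (by linarith) (hmem u)
    (hmem u') (expDecay.mul_mem (hmem v) hexp)
    (add_mem (expDecay.mul_mem (hmem v') hexp) (expDecay.mul_mem (hmem v)
      ((expDecay (-μ)).smul_mem μ hexp))) hu (fun x => ((hv x).mul (hexp' x)).congr_deriv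
        (by simp only [Pi.add_apply, Pi.smul_apply, smul_eq_mul, mul_comm μ]))
  rw [mul_zero, Real.exp_zero, mul_one] at hparts
  rw [← hparts]
  refine integral_congr_ae (Eventually.of_forall fun x => ?_)
  simp only [Pi.add_apply, Pi.smul_apply, smul_eq_mul]
  ring

end decayCore

/-! ### The embedding of the core into the weighted space -/

section ExpMeasure

variable {μ : ℝ}

theorem integral_expMeasure (g : ℝ → ℝ) :
    ∫ x, g x ∂expMeasure μ = ∫ x in Ioi 0, g x * Real.exp (μ * x) := by
  rw [expMeasure, integral_withDensity_eq_integral_toReal_smul (by fun_prop) (by simp)]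
  simp only [ENNReal.toReal_ofReal (Real.exp_pos _).le, smul_eq_mul, mul_comm]

theorem integrable_expMeasure_iff {g : ℝ → ℝ} :
    Integrable g (expMeasure μ) ↔ IntegrableOn (fun x => g x * Real.exp (μ * x)) (Ioi 0) := by
  rw [expMeasure, integrable_withDensity_iff (by fun_prop) (by simp), IntegrableOn]
  simp only [ENNReal.toReal_ofReal (Real.exp_pos _).le]

theorem ae_expMeasure : ae (expMeasure μ) = ae (volume.restrict (Ioi 0)) := by
  have hm : Measurable fun x : ℝ => ENNReal.ofReal (Real.exp (μ * x)) := by fun_prop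
  exact le_antisymm (withDensity_absolutelyContinuous _ _).ae_le
    (withDensity_absolutelyContinuous' hm.aemeasurable
      (Eventually.of_forall fun x => by simp [Real.exp_pos])).ae_le

theorem expDecay.integrable_mul_expMeasure {b c : ℝ} (h : μ < b + c) {f g : ℝ → ℝ}
    (hf : f ∈ expDecay b) (hg : g ∈ expDecay c) :
    Integrable (fun x => f x * g x) (expMeasure μ) := by
  have hexp : (fun x => Real.exp (μ * x)) ∈ expDecay (-μ) := by
    simpa only [neg_neg] using expDecay.exp_mem (-μ)
  exact integrable_expMeasure_iff.2 <|
    integrableOn_Ioi (by linarith) (mul_mem (mul_mem hf hg) hexp) 0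

theorem expDecay.memLp_expMeasure {b : ℝ} (h : μ < 2 * b) {f : ℝ → ℝ} (hf : f ∈ expDecay b) :
    MemLp f 2 (expMeasure μ) := by
  rw [memLp_two_iff_integrable_sq hf.1.aestronglyMeasurable]
  simpa only [sq] using integrable_mul_expMeasure (by linarith) hf hf

theorem inner_toLp_expMeasure {f : ℝ → ℝ} (hf : MemLp f 2 (expMeasure μ)) (h : L2Exp μ) :
    inner ℝ (hf.toLp f) h = ∫ x in Ioi 0, f x * h x * Real.exp (μ * x) := by
  rw [L2.inner_def, ← integral_expMeasure fun x => f x * h x]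
  refine integral_congr_ae ?_
  filter_upwards [hf.coeFn_toLp] with x hx
  rw [hx, RCLike.inner_apply, conj_trivial, mul_comm]

end ExpMeasure

namespace decayCore

variable {μ : ℝ} (hμ : μ < 2)

include hμ in
theorem memLp (f : decayCore) : MemLp f.1 2 (expMeasure μ) :=
  let ⟨b, hb, hμb⟩ := exists_mem_Ioo_lt_two_mul hμ
  expDecay.memLp_expMeasure hμb (mem_decayCore_iff.1 f.2 b hb)

/-- The inclusion of the core into `L²(e^{μx})`. -/
noncomputable def toL2 : decayCore →ₗ[ℝ] L2Exp μ where
  toFun f := (memLp hμ f).toLp f.1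
  map_add' f g := MemLp.toLp_add (memLp hμ f) (memLp hμ g)
  map_smul' c f := MemLp.toLp_const_smul c (memLp hμ f)

theorem coeFn_toL2 (f : decayCore) : toL2 hμ f =ᵐ[expMeasure μ] f.1 :=
  (memLp hμ f).coeFn_toLp

theorem inner_toL2 (f g : decayCore) :
    inner ℝ (toL2 hμ f) (toL2 hμ g) = ∫ x, f.1 x * g.1 x ∂expMeasure μ := by
  rw [L2.inner_def]
  refine integral_congr_ae ?_
  filter_upwards [coeFn_toL2 hμ f, coeFn_toL2 hμ g] with x hf hg
  rw [hf, hg, RCLike.inner_apply, conj_trivial, mul_comm]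

theorem norm_toL2_sq (f : decayCore) :
    ‖toL2 hμ f‖ ^ 2 = ∫ x, f.1 x * f.1 x ∂expMeasure μ := by
  rw [← real_inner_self_eq_norm_sq, inner_toL2]

theorem inner_toL2_of_hasDerivAt {u u' v v' : decayCore}
    (hu : ∀ x, HasDerivAt u.1 (u'.1 x) x) (hv : ∀ x, HasDerivAt v.1 (v'.1 x) x) :
    inner ℝ (toL2 hμ u') (toL2 hμ v) + inner ℝ (toL2 hμ u) (toL2 hμ v') +
      μ * inner ℝ (toL2 hμ u) (toL2 hμ v) = -(u.1 0 * v.1 0) := by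
  have hint (f g : decayCore) : Integrable (fun x => f.1 x * g.1 x) (expMeasure μ) :=
    (memLp hμ f).integrable_mul (memLp hμ g)
  have hint₂ : Integrable (fun x => u'.1 x * v.1 x + u.1 x * v'.1 x) (expMeasure μ) :=
    (hint u' v).add (hint u v')
  rw [inner_toL2, inner_toL2, inner_toL2, ← integral_const_mul,
    ← integral_add (hint u' v) (hint u v'), ← integral_add hint₂ ((hint u v).const_mul μ),
    integral_expMeasure, integral_mul_exp_of_hasDerivAt hμ hu hv]

/-- A continuous function of compact support as an element of the core. -/
def ofCompactSupport {f : ℝ → ℝ} (hf : Continuous f) (hs : HasCompactSupport f) : decayCore :=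
  ⟨f, mem_decayCore_iff.2 fun b _ => expDecay.mem_of_hasCompactSupport hf hs b⟩

/-- The test function `φ` as an element of the core. -/
noncomputable def ofTest (φ : 𝓓(halfLine, ℝ)) : decayCore :=
  ofCompactSupport φ.continuous φ.hasCompactSupport

theorem toL2_ofTest (φ : 𝓓(halfLine, ℝ)) : toL2 hμ (ofTest φ) = testToL2 μ hμ φ :=
  rfl

theorem ofTest_apply_zero (φ : 𝓓(halfLine, ℝ)) : (ofTest φ).1 0 = 0 :=
  image_eq_zero_of_notMem_tsupport fun h => lt_irrefl (0 : ℝ) (φ.tsupport_subset h)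

/-- The derivative of the test function `φ` as an element of the core. -/
noncomputable def derivTest (φ : 𝓓(halfLine, ℝ)) : decayCore :=
  ofCompactSupport (φ.contDiff.continuous_deriv (by simp)) φ.hasCompactSupport.deriv

theorem hasDerivAt_ofTest (φ : 𝓓(halfLine, ℝ)) (x : ℝ) :
    HasDerivAt (ofTest φ).1 ((derivTest φ).1 x) x :=
  (φ.contDiff.differentiable (by simp) x).hasDerivAt

/-- The function `x φ'(x)` as an element of the core. -/
noncomputable def eulerTest (φ : 𝓓(halfLine, ℝ)) : decayCore :=
  ofCompactSupport (f := fun x => x * deriv φ x)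
    (continuous_id.mul (φ.contDiff.continuous_deriv (by simp))) φ.hasCompactSupport.deriv.mul_left

end decayCore

theorem dense_range_testToL2 {μ : ℝ} (hμ : μ < 2) :
    Dense (LinearMap.range (testToL2 μ hμ) : Set (L2Exp μ)) := by
  rw [Submodule.dense_iff_topologicalClosure_eq_top, Submodule.topologicalClosure_eq_top_iff,
    Submodule.eq_bot_iff]
  intro h hh
  have hint : IntegrableOn (fun x => Real.exp (-x) * h x * Real.exp (μ * x)) (Ioi 0) :=
    integrable_expMeasure_iff.1 ((decayCore.memLp hμ decayCore.expNeg).integrable_mul (Lp.memLp h))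
  have hzero := isOpen_Ioi.ae_eq_zero_of_integral_contDiff_smul_eq_zero hint.locallyIntegrableOn
    fun ψ hψ hc hs => by
      let φ : 𝓓(halfLine, ℝ) :=
        { toFun := fun x => ψ x * Real.exp (-x)
          contDiff' := hψ.mul (Real.contDiff_exp.comp contDiff_neg)
          hasCompactSupport' := hc.mul_right
          tsupport_subset' := tsupport_mul_subset_left.trans hs }
      have hφ : inner ℝ (testToL2 μ hμ φ) h = 0 := (Submodule.mem_orthogonal _ _).1 hh _ ⟨φ, rfl⟩
      rw [← setIntegral_eq_integral_of_forall_compl_eq_zero (s := Ioi 0) fun x hx => by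
        rw [image_eq_zero_of_notMem_tsupport fun h => hx (hs h), zero_smul]]
      refine Eq.trans (integral_congr_ae (Eventually.of_forall fun x => ?_))
        ((inner_toLp_expMeasure (memLp_testFunction hμ φ) h).symm.trans hφ)
      change ψ x * (Real.exp (-x) * h x * Real.exp (μ * x)) =
        ψ x * Real.exp (-x) * h x * Real.exp (μ * x)
      ring
  refine (Lp.eq_zero_iff_ae_eq_zero).2 ?_
  rw [EventuallyEq, ae_expMeasure]
  filter_upwards [(ae_restrict_iff' measurableSet_Ioi).2 hzero] with x hx
  exact (mul_eq_zero_iff_left (Real.exp_ne_zero _)).1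
    ((mul_eq_zero_iff_right (Real.exp_ne_zero _)).1 hx)

theorem norm_le_div_of_mul_sq_le_inner {E : Type*} [NormedAddCommGroup E] [InnerProductSpace ℝ E]
    {c : ℝ} (hc : 0 < c) {x y : E} (h : c * ‖y‖ ^ 2 ≤ inner ℝ x y) : ‖y‖ ≤ c⁻¹ * ‖x‖ := by
  rcases (norm_nonneg y).eq_or_lt with hy | hy
  · rw [← hy]
    positivity
  · refine (le_inv_mul_iff₀ hc).2 (le_of_mul_le_mul_right ?_ hy)
    rw [mul_assoc, ← sq]
    exact h.trans (real_inner_le_norm x y)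

namespace decayCore

variable {μ : ℝ} (hμ : μ < 2)

theorem denseRange_toL2 : DenseRange (toL2 hμ) :=
  (dense_range_testToL2 hμ).mono (by rintro _ ⟨φ, rfl⟩; exact ⟨ofTest φ, rfl⟩)

theorem norm_toL2_tail_le (hμ₀ : 0 < μ) (f : decayCore) :
    ‖toL2 hμ (tail f)‖ ≤ (μ / 2)⁻¹ * ‖toL2 hμ f‖ := by
  refine norm_le_div_of_mul_sq_le_inner (half_pos hμ₀) ?_
  have h := inner_toL2_of_hasDerivAt hμ (u' := -f) (v' := -f) (hasDerivAt_tail f)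
    (hasDerivAt_tail f)
  rw [map_neg, inner_neg_left, inner_neg_right, real_inner_comm (toL2 hμ f),
    real_inner_self_eq_norm_sq] at h
  linarith [mul_self_nonneg ((tail f).1 0)]

theorem norm_toL2_conv_le (f : decayCore) :
    ‖toL2 hμ (conv f)‖ ≤ (1 - μ / 2)⁻¹ * ‖toL2 hμ f‖ := by
  refine norm_le_div_of_mul_sq_le_inner (by linarith) ?_
  have h := inner_toL2_of_hasDerivAt hμ (u' := f - conv f) (v' := f - conv f) (hasDerivAt_conv f)
    (hasDerivAt_conv f)
  have hzero : (conv f).1 0 = 0 := expConv_zero_right f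
  rw [map_sub, inner_sub_left, inner_sub_right, real_inner_comm (toL2 hμ f),
    real_inner_self_eq_norm_sq, hzero] at h
  linarith

theorem norm_toL2_dil_le (hμ₀ : 0 ≤ μ) (t : ℝ≥0) (f : decayCore) :
    ‖toL2 hμ (dil t f)‖ ≤ Real.exp (-(1 / 2) * t) * ‖toL2 hμ f‖ := by
  refine (pow_le_pow_iff_left₀ (norm_nonneg _) (by positivity) two_ne_zero).1 ?_
  have hint (g : decayCore) : IntegrableOn (fun x => g.1 x * g.1 x * Real.exp (μ * x)) (Ioi 0) :=
    integrable_expMeasure_iff.1 ((memLp hμ g).integrable_mul (memLp hμ g))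
  have hexp : Real.exp (-(1 / 2) * t) ^ 2 = (Real.exp t)⁻¹ := by
    rw [← Real.exp_nat_mul, ← Real.exp_neg]
    ring_nf
  have hscale := integral_comp_mul_left_Ioi (fun x => f.1 x * f.1 x * Real.exp (μ * x)) 0
    (Real.exp_pos t)
  have hscaled := (integrableOn_Ioi_comp_mul_left_iff
    (fun x => f.1 x * f.1 x * Real.exp (μ * x)) 0 (Real.exp_pos t)).2
      (by simpa only [mul_zero] using hint f)
  rw [mul_zero, smul_eq_mul] at hscale
  rw [mul_pow, hexp, norm_toL2_sq, norm_toL2_sq, integral_expMeasure,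
    integral_expMeasure, ← hscale]
  refine setIntegral_mono_on (hint (dil t f)) hscaled measurableSet_Ioi fun x hx => ?_
  refine mul_le_mul_of_nonneg_left (Real.exp_le_exp.2 ?_) (mul_self_nonneg _)
  exact mul_le_mul_of_nonneg_left
    (le_mul_of_one_le_left (le_of_lt hx) (Real.one_le_exp t.2)) hμ₀

theorem tendsto_toL2 {ι : Type*} {l : Filter ι} [l.IsCountablyGenerated] {g : ι → decayCore}
    {f : decayCore} {b C : ℝ} (hb : b ∈ Ioo (0 : ℝ) 1) (hμb : μ < 2 * b)
    (hbound : ∀ᶠ i in l, ∀ x, 0 ≤ x → |(g i).1 x| ≤ C * Real.exp (-b * x))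
    (hlim : ∀ x, 0 < x → Tendsto (fun i => (g i).1 x) l (𝓝 (f.1 x))) :
    Tendsto (fun i => toL2 hμ (g i)) l (𝓝 (toL2 hμ f)) := by
  obtain ⟨C', -, hC'⟩ := expDecay.exists_bound (mem_decayCore_iff.1 f.2 b hb)
  set w : ℝ → ℝ := fun x => (C + C') * Real.exp (-b * x)
  have hw : w ∈ expDecay b := (expDecay b).smul_mem (C + C') (expDecay.exp_mem b)
  have hsq : Tendsto (fun i => ‖toL2 hμ (g i - f)‖ ^ 2) l (𝓝 0) := by
    simp only [norm_toL2_sq]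
    rw [← integral_zero ℝ ℝ (μ := expMeasure μ)]
    refine tendsto_integral_filter_of_dominated_convergence (fun x => w x * w x)
      (Eventually.of_forall fun i => ((memLp hμ (g i - f)).1.mul (memLp hμ (g i - f)).1)) ?_
      (expDecay.integrable_mul_expMeasure (by linarith) hw hw) ?_
    · filter_upwards [hbound] with i hi
      rw [ae_expMeasure]
      filter_upwards [ae_restrict_mem measurableSet_Ioi] with x hx
      have hle : |(g i).1 x - f.1 x| ≤ w x := (abs_sub _ _).trans
        ((add_le_add (hi x (le_of_lt hx)) (hC' x (le_of_lt hx))).trans_eq (add_mul _ _ _).symm)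
      rw [norm_mul]
      exact mul_self_le_mul_self (abs_nonneg _) hle
    · rw [ae_expMeasure]
      filter_upwards [ae_restrict_mem measurableSet_Ioi] with x hx
      have h := tendsto_sub_nhds_zero_iff.2 (hlim x hx)
      rw [← mul_zero (0 : ℝ)]
      exact h.mul h
  rw [tendsto_iff_norm_sub_tendsto_zero]
  simpa only [map_sub, Real.sqrt_sq (norm_nonneg _), Real.sqrt_zero] using hsq.sqrt

end decayCore

/-! ### The dilation triple on the weighted space -/

section Extension

open decayCore

theorem continuous_apply_of_denseRange {X ι E F : Type*} [TopologicalSpace X]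
    [NormedAddCommGroup E] [NormedSpace ℝ E] [NormedAddCommGroup F] [NormedSpace ℝ F]
    {A : X → E →L[ℝ] F} {C : ℝ≥0} (hA : ∀ t, ‖A t‖₊ ≤ C) {e : ι → E} (he : DenseRange e)
    (hcont : ∀ i, Continuous fun t => A t (e i)) (x : E) : Continuous fun t => A t x := by
  have hequi := (LipschitzWith.uniformEquicontinuous (fun t => ⇑(A t)) C fun t =>
    (A t).lipschitz.weaken (hA t)).equicontinuous
  refine continuous_iff_continuousAt.2 fun t => ?_
  refine (hequi x).tendsto_of_mem_closure ((A t).continuous.continuousWithinAt (s := range e))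
    ?_ (he x)
  rintro _ ⟨i, rfl⟩
  exact (hcont i).continuousAt

variable {μ : ℝ} (hμ : μ < 2)

/-- The extension to `L²(e^{μx})` of an operator on the core that is bounded for the norm of
`L²(e^{μx})`. -/
noncomputable def extendCore (A : decayCore →ₗ[ℝ] decayCore) : L2Exp μ →L[ℝ] L2Exp μ :=
  (toL2 hμ ∘ₗ A).extendOfNorm (toL2 hμ)

theorem extendCore_toL2 {A : decayCore →ₗ[ℝ] decayCore} {C : ℝ}
    (hA : ∀ f, ‖toL2 hμ (A f)‖ ≤ C * ‖toL2 hμ f‖) (f : decayCore) :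
    extendCore hμ A (toL2 hμ f) = toL2 hμ (A f) :=
  LinearMap.extendOfNorm_eq (denseRange_toL2 hμ) ⟨C, hA⟩ f

theorem ext_toL2 {F : Type*} [NormedAddCommGroup F] [NormedSpace ℝ F] {A B : L2Exp μ →L[ℝ] F}
    (h : ∀ f, A (toL2 hμ f) = B (toL2 hμ f)) : A = B :=
  DFunLike.coe_injective ((denseRange_toL2 hμ).equalizer A.continuous B.continuous (funext h))

variable (hμ₀ : 0 < μ)
include hμ₀

theorem extendCore_tail_toL2 (f : decayCore) :
    extendCore hμ tail (toL2 hμ f) = toL2 hμ (tail f) :=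
  extendCore_toL2 hμ (norm_toL2_tail_le hμ hμ₀) f

omit hμ₀ in
theorem extendCore_conv_toL2 (f : decayCore) :
    extendCore hμ conv (toL2 hμ f) = toL2 hμ (conv f) :=
  extendCore_toL2 hμ (norm_toL2_conv_le hμ) f

theorem extendCore_dil_toL2 (t : ℝ≥0) (f : decayCore) :
    extendCore hμ (dil t) (toL2 hμ f) = toL2 hμ (dil t f) :=
  extendCore_toL2 hμ (norm_toL2_dil_le hμ hμ₀.le t) f

theorem norm_extendCore_dil_le (t : ℝ≥0) :
    ‖extendCore hμ (dil t)‖ ≤ Real.exp (-(1 / 2) * t) :=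
  LinearMap.opNorm_extendOfNorm_le (denseRange_toL2 hμ) (Real.exp_pos _).le
    (norm_toL2_dil_le hμ hμ₀.le t)

omit hμ₀ in
theorem continuous_toL2_dil (f : decayCore) : Continuous fun t => toL2 hμ (dil t f) := by
  obtain ⟨b, hb, hμb⟩ := exists_mem_Ioo_lt_two_mul hμ
  obtain ⟨C, hC⟩ := expDecay.exists_bound_comp_mul_left hb.1.le (mem_decayCore_iff.1 f.2 b hb)
  refine continuous_iff_continuousAt.2 fun t => tendsto_toL2 hμ hb hμb (C := C)
    (Eventually.of_forall fun s => hC _ (Real.one_le_exp s.2)) fun x _ => ?_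
  exact ((decayCore.continuous f).comp (by fun_prop :
    Continuous fun s : ℝ≥0 => Real.exp s * x)).continuousAt

theorem continuous_extendCore_dil (h : L2Exp μ) :
    Continuous fun t => extendCore hμ (dil t) h := by
  refine continuous_apply_of_denseRange (C := 1) (fun t => ?_) (denseRange_toL2 hμ)
    (fun f => ?_) h
  · exact (norm_extendCore_dil_le hμ hμ₀ t).trans
      (Real.exp_le_one_iff.2 (mul_nonpos_of_nonpos_of_nonneg (by norm_num) t.2))
  · simpa only [extendCore_dil_toL2 hμ hμ₀] using continuous_toL2_dil hμ f

/-- The semigroup of dilations `h ↦ h(e^t ·)` on `L²(e^{μx})`. -/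
noncomputable def dilationSemigroup : C0Semigroup (L2Exp μ) where
  op t := extendCore hμ (dil t)
  op_zero := ext_toL2 hμ fun f => by
    rw [extendCore_dil_toL2 hμ hμ₀]
    exact congrArg (toL2 hμ) (dil_zero f)
  op_add s t := ext_toL2 hμ fun f => by
    rw [ContinuousLinearMap.comp_apply, extendCore_dil_toL2 hμ hμ₀, extendCore_dil_toL2 hμ hμ₀,
      extendCore_dil_toL2 hμ hμ₀, dil_add]
  continuous_orbit := continuous_extendCore_dil hμ hμ₀

theorem hasGen_dilationSemigroup {f g : decayCore} {f' : ℝ → ℝ}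
    (hf : ∀ x, HasDerivAt f.1 (f' x) x) (hg : ∀ x, g.1 x = x * f' x) :
    (dilationSemigroup hμ hμ₀).HasGen (toL2 hμ f) (toL2 hμ g) := by
  obtain ⟨b, hb, hμb⟩ := exists_mem_Ioo_lt_two_mul hμ
  obtain ⟨C, hC⟩ := expDecay.exists_bound_comp_mul_left hb.1.le (mem_decayCore_iff.1 g.2 b hb)
  have hderiv (x s : ℝ) :
      HasDerivAt (fun s => f.1 (Real.exp s * x)) (g.1 (Real.exp s * x)) s := by
    refine ((hf (Real.exp s * x)).comp s ((Real.hasDerivAt_exp s).mul_const x)).congr_deriv ?_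
    rw [hg, mul_comm]
  have hslope (t : ℝ≥0) : (t : ℝ)⁻¹ • ((dilationSemigroup hμ hμ₀).op t (toL2 hμ f) - toL2 hμ f) =
      toL2 hμ ((t : ℝ)⁻¹ • (dil t f - f)) := by
    rw [map_smul, map_sub, ← extendCore_dil_toL2 hμ hμ₀]
    rfl
  simp only [C0Semigroup.HasGen, hslope]
  refine tendsto_toL2 hμ hb hμb (C := C) ?_ fun x _ => ?_
  · filter_upwards [self_mem_nhdsWithin] with t (ht : (0 : ℝ) < t) x hx
    have hmean := norm_image_sub_le_of_norm_deriv_le_segment' (a := 0) (b := t)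
      (fun s _ => (hderiv x s).hasDerivWithinAt)
      (fun s hs => hC _ (Real.one_le_exp hs.1) x hx) t ⟨ht.le, le_rfl⟩
    rw [sub_zero, Real.exp_zero, one_mul, Real.norm_eq_abs, mul_comm _ (t : ℝ),
      ← inv_mul_le_iff₀ ht] at hmean
    change |(t : ℝ)⁻¹ * (f.1 (Real.exp t * x) - f.1 x)| ≤ _
    rwa [abs_mul, abs_of_pos (inv_pos.2 ht)]
  · have hlim := tendsto_nnreal_slope_zero (hderiv x 0)
    simp only [Real.exp_zero, one_mul] at hlim
    exact hlim

theorem inner_testToL2 (φ : 𝓓(halfLine, ℝ)) (h : L2Exp μ) :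
    inner ℝ h (testToL2 μ hμ φ) = inner ℝ (extendCore hμ tail h)
      (toL2 hμ (derivTest φ) + μ • testToL2 μ hμ φ) := by
  refine (denseRange_toL2 hμ).induction_on h (isClosed_eq (by fun_prop) (by fun_prop)) fun f => ?_
  have hparts := inner_toL2_of_hasDerivAt hμ (u' := -f) (hasDerivAt_tail f)
    (hasDerivAt_ofTest φ)
  rw [ofTest_apply_zero, mul_zero, neg_zero, map_neg, inner_neg_left] at hparts
  rw [extendCore_tail_toL2 hμ hμ₀, inner_add_right, inner_smul_right, ← toL2_ofTest]
  linarith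

theorem extendCore_tail_injective : Function.Injective (extendCore hμ tail) := by
  refine (injective_iff_map_eq_zero _).2 fun h hh => ?_
  refine (dense_range_testToL2 hμ).eq_zero_of_inner_left ℝ ?_
  rintro _ ⟨φ, rfl⟩
  rw [inner_testToL2 hμ hμ₀, hh, inner_zero_left]

/-- The dilations, the tail primitive and the convolution with `e^{-x}` on `L²(e^{μx})`. -/
noncomputable def dilationTriple : DilationTriple (L2Exp μ) where
  dil := dilationSemigroup hμ hμ₀
  tail := extendCore hμ tail
  conv := extendCore hμ conv
  tail_injective := extendCore_tail_injective hμ hμ₀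
  tail_dil t h := by
    refine (denseRange_toL2 hμ).induction_on h (isClosed_eq (by fun_prop) (by fun_prop)) fun f => ?_
    simp only [dilationSemigroup, extendCore_dil_toL2 hμ hμ₀, extendCore_tail_toL2 hμ hμ₀, tail_dil,
      map_smul]
  tail_conv h := by
    refine (denseRange_toL2 hμ).induction_on h (isClosed_eq (by fun_prop) (by fun_prop)) fun f => ?_
    simp only [extendCore_conv_toL2, extendCore_tail_toL2 hμ hμ₀, tail_conv, map_add]
  conv_dil t h := by
    refine (denseRange_toL2 hμ).induction_on h (isClosed_eq (by fun_prop) (by fun_prop)) fun f => ?_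
    simp only [dilationSemigroup, extendCore_dil_toL2 hμ hμ₀, extendCore_conv_toL2]
    rw [conv_dil, map_add, map_smul, map_smul]

end Extension

/-! ### Generation and decay -/

section Coagulation

open decayCore

variable {μ : ℝ}

theorem memLp_id_mul_exp (hμ₀ : 0 < μ) :
    MemLp (fun x => x * Real.exp (-μ * x)) 2 (expMeasure μ) :=
  expDecay.memLp_expMeasure (b := -(μ / 4) + μ) (by linarith)
    (expDecay.mul_mem (expDecay.id_mem (by linarith)) (expDecay.exp_mem μ))

/-- The first moment `∫₀^∞ x h(x) dx`, represented by `x e^{-μx}` in `L²(e^{μx})`. -/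
noncomputable def moment (hμ₀ : 0 < μ) : L2Exp μ →L[ℝ] ℝ :=
  innerSL ℝ ((memLp_id_mul_exp hμ₀).toLp _)

theorem moment_apply (hμ₀ : 0 < μ) (h : L2Exp μ) : moment hμ₀ h = ∫ x in Ioi 0, x * h x := by
  rw [moment, innerSL_apply_apply, inner_toLp_expMeasure]
  refine integral_congr_ae (Eventually.of_forall fun x => ?_)
  have hexp : Real.exp (-μ * x) * Real.exp (μ * x) = 1 := by
    rw [← Real.exp_add, neg_mul, neg_add_cancel, Real.exp_zero]
  linear_combination x * h x * hexp

variable (hμ : μ < 2) (hμ₀ : 0 < μ)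

theorem defect_tail_dilationTriple (h : L2Exp μ) :
    (dilationTriple hμ hμ₀).defect ((dilationTriple hμ hμ₀).tail h) =
      moment hμ₀ h • toL2 hμ expNeg := by
  refine (denseRange_toL2 hμ).induction_on h (isClosed_eq (by fun_prop) (by fun_prop)) fun f => ?_
  have hmoment : moment hμ₀ (toL2 hμ f) = ∫ x in Ioi 0, x * f.1 x := by
    have hae := coeFn_toL2 hμ f
    rw [EventuallyEq, ae_expMeasure] at hae
    rw [moment_apply]
    exact integral_congr_ae (hae.mono fun x hx => congrArg (x * ·) hx)
  rw [hmoment, ← integral_tail, ← map_smul, ← conv_add_tail_sub_conv_tail]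
  simp only [DilationTriple.defect_apply, dilationTriple, extendCore_tail_toL2 hμ hμ₀,
    extendCore_conv_toL2, map_add, map_sub]

theorem linCoagToL2_eq (φ : 𝓓(halfLine, ℝ)) :
    linCoagToL2 μ hμ φ =
      toL2 hμ (eulerTest φ) + (dilationTriple hμ hμ₀).perturbation (testToL2 μ hμ φ) := by
  simp only [DilationTriple.perturbation_apply, DilationTriple.coConv_apply, dilationTriple]
  rw [← toL2_ofTest, extendCore_tail_toL2 hμ hμ₀, extendCore_conv_toL2, ← map_sub, ← map_smul,
    ← map_add]
  refine MemLp.toLp_congr (memLp_linCoag hμ φ) (memLp hμ _) (Eventually.of_forall fun x => ?_)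
  change x * deriv φ x - 2 * tailPrimitive φ x + 2 * expConv (tailPrimitive φ) x =
    x * deriv φ x + -2 * (tailPrimitive φ x - expConv (tailPrimitive φ) x)
  ring

omit hμ₀ in
theorem exists_of_mem_linCoagOp_graph {x y : L2Exp μ} (hxy : (x, y) ∈ (linCoagOp μ hμ).graph) :
    ∃ φ, testToL2 μ hμ φ = x ∧ linCoagToL2 μ hμ φ = y := by
  obtain ⟨φ, hx, hy⟩ := (mem_linCoagOp_graph_iff μ hμ x y).1 hxy
  exact ⟨φ, Lp.ext ((MemLp.coeFn_toLp (memLp_testFunction hμ φ)).trans hx.symm),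
    Lp.ext ((MemLp.coeFn_toLp (memLp_linCoag hμ φ)).trans hy.symm)⟩

theorem neg_perturbation_vadd_linCoagOp_le :
    -((dilationTriple hμ hμ₀).perturbation : L2Exp μ →ₗ[ℝ] L2Exp μ) +ᵥ linCoagOp μ hμ ≤
      (dilationSemigroup hμ hμ₀).generator := by
  refine LinearPMap.le_of_le_graph ?_
  rintro ⟨x, y⟩ hxy
  obtain ⟨φ, rfl, hy⟩ := exists_of_mem_linCoagOp_graph hμ ((mem_vadd_graph_iff _ _ x y).1 hxy)
  rw [linCoagToL2_eq hμ hμ₀, LinearMap.neg_apply, sub_neg_eq_add, ContinuousLinearMap.coe_coe,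
    add_left_inj] at hy
  rw [C0Semigroup.mem_generator_graph_iff, ← hy, ← toL2_ofTest]
  exact hasGen_dilationSemigroup hμ hμ₀ (hasDerivAt_ofTest φ) fun x => rfl

/-- The dilation of a test function. -/
noncomputable def dilTest (t : ℝ) (φ : 𝓓(halfLine, ℝ)) : 𝓓(halfLine, ℝ) where
  toFun x := φ (Real.exp t * x)
  contDiff' := φ.contDiff.comp (contDiff_const.mul contDiff_id)
  hasCompactSupport' :=
    φ.hasCompactSupport.comp_homeomorph (Homeomorph.mulLeft₀ _ (Real.exp_pos t).ne')
  tsupport_subset' := by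
    refine (tsupport_comp_subset_preimage φ (by fun_prop)).trans fun x hx => ?_
    exact (mul_pos_iff_of_pos_left (Real.exp_pos t)).1 (φ.tsupport_subset hx)

theorem dilationSemigroup_testToL2 (t : ℝ≥0) (φ : 𝓓(halfLine, ℝ)) :
    (dilationSemigroup hμ hμ₀).op t (testToL2 μ hμ φ) = testToL2 μ hμ (dilTest t φ) :=
  extendCore_dil_toL2 hμ hμ₀ t (ofTest φ)

theorem generates_linCoagOp :
    Generates (linCoagOp μ hμ) (dilationTriple hμ hμ₀).semigroup := by
  have hdil := generates_of_dense_of_invariant (neg_perturbation_vadd_linCoagOp_le hμ hμ₀)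
    (dense_range_testToL2 hμ) (by
      rintro _ ⟨φ, rfl⟩ t
      exact ⟨dilTest t φ, (dilationSemigroup_testToL2 hμ hμ₀ t φ).symm⟩)
  simpa only [vadd_neg_vadd] using (dilationTriple hμ hμ₀).generates_semigroup hdil

theorem exists_norm_semigroup_le :
    ∃ C, 0 < C ∧ ∀ h : L2Exp μ, ∫ x in Ioi 0, x * h x = 0 → ∀ t : ℝ≥0,
      ‖(dilationTriple hμ hμ₀).semigroup.op t h‖ ≤ C * Real.exp (-(1 / 2) * t) * ‖h‖ := by
  set S := dilationTriple hμ hμ₀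
  refine ⟨(1 + ‖S.coConv‖ * ‖S.tail‖) ^ 2, by positivity, fun h hh t =>
    (S.norm_op_apply_le ?_ t).trans ?_⟩
  · rw [defect_tail_dilationTriple, moment_apply, hh, zero_smul]
  · gcongr
    exact norm_extendCore_dil_le hμ hμ₀ t

end Coagulation

theorem proposition6p1_general (μ : ℝ) (hμ₀ : 0 < μ) (hμ : μ < 2) :
    ∃ T : C0Semigroup (L2Exp μ),
      Generates (linCoagOp μ hμ) T ∧
      ∀ lam : ℝ, lam ≤ 1 / 2 → ∃ C : ℝ, 0 < C ∧
        ∀ h₀ : L2Exp μ, ∫ x in Ioi (0 : ℝ), x * h₀ x = 0 →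
          ∀ t : ℝ≥0, ‖T.op t h₀‖ ≤ C * Real.exp (-lam * t) * ‖h₀‖ := by
  refine ⟨_, generates_linCoagOp hμ hμ₀, fun lam hlam => ?_⟩
  obtain ⟨C, hC₀, hC⟩ := exists_norm_semigroup_le hμ hμ₀
  refine ⟨C, hC₀, fun h₀ hh t => (hC h₀ hh t).trans ?_⟩
  gcongr

theorem proposition6p1 (μ : ℝ) (hμ₀ : 0 < μ) (hμ₁ : μ < 1) :
    ∃ T : C0Semigroup (L2Exp μ),
      Generates (linCoagOp μ (hμ₁.trans one_lt_two)) T ∧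
      ∀ lam : ℝ, lam ≤ 1 / 2 → ∃ C : ℝ, 0 < C ∧
        ∀ h₀ : L2Exp μ, ∫ x in Ioi (0 : ℝ), x * h₀ x = 0 →
          ∀ t : ℝ≥0, ‖T.op t h₀‖ ≤ C * Real.exp (-lam * t) * ‖h₀‖ := by
  exact proposition6p1_general μ hμ₀ (hμ₁.trans one_lt_two)
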